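/- **Setting.** Fix a set $I$ of term constructors. Raw *types* $A$, *terms* $t$ and *substitutions* $\gamma$ are generated by $$A ::= \star \mid {\Rightarrow} A\,t\,u,\qquad t ::= x \mid c_i[\gamma]\ (i\in I),\qquad \gamma ::= \langle\rangle \mid \langle \gamma, x\mapsto t\rangle ,$$ with variables $x\in\mathbb N$; raw *contexts* are $\Gamma ::= \emptyset\mid \Gamma,x:A$, and $\ell(\Gamma)$ is the length. Substitution is defined by $\star[\gamma]=\star$, $(\Rightarrow A\,t\,u)[\gamma]=\ \Rightarrow A[\gamma]\,t[\gamma]\,u[\gamma]$, $x[\langle\rangle]=x$, $x[\langle\gamma,v\mapsto t\rangle]=t$ if $x=v$ and $x[\gamma]$ otherwise, $c_i[\gamma][\delta]=c_i[\gamma\circ\delta]$, $\langle\rangle\circ\delta=\langle\rangle$, $\langle\gamma,x\mapsto t\rangle\circ\delta=\langle\gamma\circ\delta,x\mapsto t[\delta]\rangle$. Put $\mathrm{id}_\emptyset=\langle\rangle$, $\mathrm{id}_{\Gamma,x:A}=\langle\mathrm{id}_\Gamma,x\mapsto x\rangle$. The dimension is $\dim\star=0$, $\dim(\Rightarrow A\,t\,u)=\dim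 A+1$; $\dim\Gamma$ is the maximum of the dimensions of the types in $\Gamma$ (and $0$ for $\emptyset$). $\mathrm{Var}$ of a type, term or substitution is the set of variables occurring in it, with $\mathrm{Var}(c_i[\gamma])=\mathrm{Var}(\gamma)=\bigcup_{(x\mapsto t)\in\gamma}\mathrm{Var}(t)$; $\mathrm{Var}(\Gamma)$ is the set of variables declared by $\Gamma$. *Globular type theories.* Given for each $i\in I$ a raw context $C_i$ without term constructors and a raw type $T_i$, the judgements $\Gamma\vdash$, $\Gamma\vdash A$, $\Gamma\vdash t:A$, $\Delta\vdash\gamma:\Gamma$ have the following rules. - $\emptyset\vdash$; and $\Gamma,x:A\vdash$ if $\Gamma\vdash$, $\Gamma\vdash A$ and $x=\ell(\Gamma)$. - $\Gamma\vdash\star$ if $\Gamma\vdash$; and $\Gamma\vdash\ \Rightarrow A\,t\,u$ if $\Gamma\vdash t:A$ and $\Gamma\vdash u:A$. - $\Gamma\vdash x:A$ if $\Gamma\vdash$ and $(x:A)\in\Gamma$; and $\Delta\vdash c_i[\gamma]:T_i[\gamma]$ if $C_i\vdash T_i$ and $\Delta\vdash\gamma:C_i$. - $\Delta\vdash\langle\rangle:\emptyset$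 if $\Delta\vdash$; and $\Delta\vdash\langle\gamma,x\mapsto t\rangle:(\Gamma,x:A)$ if $\Delta\vdash\gamma:\Gamma$, $\Gamma,x:A\vdash$ and $\Delta\vdash t:A[\gamma]$. For $I=\varnothing$ this is the theory $\mathsf{Glob}$; in general the contexts $C_i$ are required to be derivable in $\mathsf{Glob}$. *Ps-contexts.* On raw contexts of $\mathsf{Glob}$, the judgement $\Gamma\vdash_{ps}x:A$ has the rules: $(0:\star)\vdash_{ps}0:\star$ (pss); if $\Gamma\vdash_{ps}f:\ \Rightarrow A\,x\,y$ then $\Gamma\vdash_{ps}y:A$ (psd); if $\Gamma\vdash_{ps}x:A$ and $l=\ell(\Gamma)$, then $(\Gamma,\ l:A,\ l+1:\ \Rightarrow A\,x\,l)\vdash_{ps}l+1:\ \Rightarrow A\,x\,l$ (pse). And $\Gamma\vdash_{ps}$ if $\Gamma\vdash_{ps}x:\star$. A ps-context is a $\Gamma$ with a derivation of $\Gamma\vdash_{ps}$. By induction on that derivation, define lists $\partial_i^-,\partial_i^+$ of variables: both are $()$ for pss if $i=0$, and $(0)$ for pss if $i>0$; psd leaves both unchanged; pse appends $l,l+1$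 to both if $i>\dim A+1$, leaves $\partial^-_i$ unchanged if $i\le\dim A+1$, leaves $\partial_i^+$ unchanged if $i<\dim A+1$, and replaces the last element of $\partial_i^+$ by $l$ if $i=\dim A+1$. Let $\partial^\pm\Gamma$ be the set of elements of $\partial^\pm_{\dim\Gamma}$. A raw type $B$ is *full* in $\Gamma$ if either $B=\ \Rightarrow A\,t\,u$ with $\partial^-\Gamma=\mathrm{Var}(A)\cup\mathrm{Var}(t)$ and $\partial^+\Gamma=\mathrm{Var}(A)\cup\mathrm{Var}(u)$, or $\mathrm{Var}(\Gamma)=\mathrm{Var}(B)$. *The theory $\mathsf{CaTT}$* is the globular type theory indexed by the (inductively generated) set $J$ of pairs $(\Gamma,A)$ of a ps-context $\Gamma$ and a raw type $A$ over $J$ that is full in $\Gamma$, with $C_{(\Gamma,A)}=\Gamma$ and $T_{(\Gamma,A)}=A$. Define $U_0=\star$, $U_{n+1}=\ \Rightarrow U_n\,(2n)\,(2n+1)$, $\mathbb S^0=\emptyset$, $\mathbb D^n=(\mathbb S^n,\ \ell(\mathbb S^n):U_n)$, $\mathbb S^{n+1}=(\mathbb D^n,\ \ell(\mathbb D^n):U_n)$.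 **Theorem.** In the theory $\mathsf{CaTT}$ the following hold. 1. *(Weakening and preservation of derivability.)* If $\Gamma,y:B\vdash$, then $\Gamma\vdash A$ implies $\Gamma,y:B\vdash A$, $\Gamma\vdash t:A$ implies $\Gamma,y:B\vdash t:A$, and $\Gamma\vdash\gamma:\Theta$ implies $\Gamma,y:B\vdash\gamma:\Theta$. Moreover $\Gamma\vdash A$ implies $\Gamma\vdash$; $\Gamma\vdash t:A$ implies $\Gamma\vdash$ and $\Gamma\vdash A$; $\Delta\vdash\gamma:\Gamma$ implies $\Gamma\vdash$ and $\Delta\vdash$; $\Gamma,x:A\vdash$ implies $\Gamma\vdash$; and $\Gamma\vdash\ \Rightarrow A\,t\,u$ implies $\Gamma\vdash t:A$ and $\Gamma\vdash u:A$. 2. *(Category with families.)* For all raw contexts, types, terms and substitutions, $A[\mathrm{id}_\Gamma]=A$, $t[\mathrm{id}_\Gamma]=t$ and $\gamma\circ\mathrm{id}_\Delta=\gamma$. The derivable contexts, substitutions (those with $\Delta\vdash\gamma:\Gamma$ as morphisms $\Delta\to\Gamma$), types and terms form a category with families, whose identities, composition and action on types and terms are the operations above, whose terminal object is $\emptyset$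 with morphisms $\langle\rangle$ into it, and whose comprehension of $\Gamma\vdash A$ is $\Gamma,\ell(\Gamma):A$, with projection $\mathrm{id}_\Gamma$, last variable $\ell(\Gamma)$ and pairing $\langle\gamma,\ell(\Gamma)\mapsto t\rangle$. 3. *(Uniqueness of derivations.)* Every judgement $\Gamma\vdash$, $\Gamma\vdash A$, $\Gamma\vdash t:A$, $\Delta\vdash\gamma:\Gamma$, $\Gamma\vdash_{ps}x:A$, $\Gamma\vdash_{ps}$ has at most one derivation tree. 4. *(Spheres classify types.)* For every $n$, $\mathbb S^n\vdash$, $\mathbb D^n\vdash$ and $\mathbb S^n\vdash U_n$. For every $\Gamma$, the map $(n,\gamma)\mapsto U_n[\gamma]$ is a bijection from the pairs of an $n\in\mathbb N$ and a substitution $\Gamma\vdash\gamma:\mathbb S^n$ to the types $A$ with $\Gamma\vdash A$. 5. *(Decidability of type checking.)* The standard Gödel numbering of the raw syntax (in which the number of a term constructor $(\Gamma,A)\in J$ is the pair of the numbers of the raw context $\Gamma$ and the type $A$) is injective, and with respect to it the sets $\{\Gamma : \Gamma\vdash\}$, $\{(\Gamma,A):\Gamma\vdash A\}$, $\{(\Gamma,t,A):\Gamma\vdash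 t:A\}$ and $\{(\Delta,\Gamma,\gamma):\Delta\vdash\gamma:\Gamma\}$ are computable (as sets of, or relations between, natural numbers). -/

import Mathlib

/-! ### Raw syntax of globular type theories, with term constructors indexed by `I` -/

mutual
/-- Raw types: the type of objects, and arrow types. -/
inductive PreTy (I : Type) : Type where
  | obj : PreTy I
  | arr : PreTy I → PreTm I → PreTm I → PreTy I

/-- Raw terms: variables (which are numbers), and constructors applied to a substitution. -/
inductive PreTm (I : Type) : Type where
  | var : ℕ → PreTm I
  | con : I → PreSub I → PreTm I

/-- Raw substitutions: `γ.snoc x t` is `⟨γ, x ↦ t⟩`. -/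
inductive PreSub (I : Type) : Type where
  | nil : PreSub I
  | snoc : PreSub I → ℕ → PreTm I → PreSub I
end

/-- Raw contexts: `Γ.snoc x A` is `Γ, x : A`. -/
inductive PreCtx (I : Type) : Type where
  | nil : PreCtx I
  | snoc : PreCtx I → ℕ → PreTy I → PreCtx I

section RawOperations

variable {I : Type}

/-- The result of the lookup `x[γ]` of a variable in a substitution. -/
def PreSub.lookup : PreSub I → ℕ → PreTm I
  | .nil, x => .var x
  | .snoc γ v t, x => if x = v then t else γ.lookup x

mutual
/-- The action `A[γ]` of a substitution on a type. -/
def PreTy.subst : PreTy I → PreSub I → PreTy I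
  | .obj, _ => .obj
  | .arr A t u, γ => .arr (A.subst γ) (t.subst γ) (u.subst γ)

/-- The action `t[γ]` of a substitution on a term. -/
def PreTm.subst : PreTm I → PreSub I → PreTm I
  | .var x, γ => γ.lookup x
  | .con i γ, δ => .con i (γ.comp δ)

/-- The composition `γ ∘ δ` of substitutions. -/
def PreSub.comp : PreSub I → PreSub I → PreSub I
  | .nil, _ => .nil
  | .snoc γ x t, δ => .snoc (γ.comp δ) x (t.subst δ)
end

/-- The length of a context. -/
def PreCtx.length : PreCtx I → ℕ
  | .nil => 0
  | .snoc Γ _ _ => Γ.length + 1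

/-- The identity substitution of a context. -/
def PreSub.ident : PreCtx I → PreSub I
  | .nil => .nil
  | .snoc Γ x _ => .snoc (PreSub.ident Γ) x (.var x)

/-- The dimension of a type: its number of iterated arrows. -/
def PreTy.dim : PreTy I → ℕ
  | .obj => 0
  | .arr A _ _ => A.dim + 1

/-- The dimension of a context: the maximal dimension of the types it contains. -/
def PreCtx.dim : PreCtx I → ℕ
  | .nil => 0
  | .snoc Γ _ A => max Γ.dim A.dim

mutual
/-- The set of variables of a type. -/
def PreTy.vars : PreTy I → Finset ℕ
  | .obj => ∅
  | .arr A t u => A.vars ∪ t.vars ∪ u.vars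

/-- The set of variables of a term. -/
def PreTm.vars : PreTm I → Finset ℕ
  | .var x => {x}
  | .con _ γ => γ.vars

/-- The set of variables of (the terms of) a substitution. -/
def PreSub.vars : PreSub I → Finset ℕ
  | .nil => ∅
  | .snoc γ _ t => γ.vars ∪ t.vars
end

/-- The set of variables declared by a context. -/
def PreCtx.vars : PreCtx I → Finset ℕ
  | .nil => ∅
  | .snoc Γ x _ => Γ.vars ∪ {x}

/-- The (proof-relevant) relation `(x : A) ∈ Γ`. -/
inductive PreCtx.Mem : ℕ → PreTy I → PreCtx I → Type where
  | here {Γ : PreCtx I} {x : ℕ} {A : PreTy I} : PreCtx.Mem x A (Γ.snoc x A)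
  | there {Γ : PreCtx I} {x y : ℕ} {A B : PreTy I} :
      PreCtx.Mem x A Γ → PreCtx.Mem x A (Γ.snoc y B)

end RawOperations

/-! The theory `Glob` has no term constructor, so its raw syntax is the raw syntax over the empty
index type. It embeds in the raw syntax over any index type. -/

mutual
def PreTy.lift (I : Type) : PreTy Empty → PreTy I
  | .obj => .obj
  | .arr A t u => .arr (A.lift I) (t.lift I) (u.lift I)

def PreTm.lift (I : Type) : PreTm Empty → PreTm I
  | .var x => .var x
  | .con i _ => i.elim
end

def PreCtx.lift (I : Type) : PreCtx Empty → PreCtx I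
  | .nil => .nil
  | .snoc Γ x A => .snoc (Γ.lift I) x (A.lift I)

/-! ### Judgements -/

/-- The data that parameterises the introduction rules of the term constructors: the constructor `i`
takes a substitution to the context `Ci i`, and has the type `Ti i`. -/
structure Signature (I : Type) where
  Ci : I → PreCtx Empty
  Ti : I → PreTy I

mutual
/-- Derivation trees of `Γ ⊢`. -/
inductive CtxD {I : Type} (S : Signature I) : PreCtx I → Type where
  | ec : CtxD S .nil
  | cc {Γ : PreCtx I} {x : ℕ} {A : PreTy I} :
      CtxD S Γ → TyD S Γ A → x = Γ.length → CtxD S (Γ.snoc x A)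

/-- Derivation trees of `Γ ⊢ A`. -/
inductive TyD {I : Type} (S : Signature I) : PreCtx I → PreTy I → Type where
  | ob {Γ : PreCtx I} : CtxD S Γ → TyD S Γ .obj
  | ar {Γ : PreCtx I} {A : PreTy I} {t u : PreTm I} :
      TmD S Γ t A → TmD S Γ u A → TyD S Γ (.arr A t u)

/-- Derivation trees of `Γ ⊢ t : A`. -/
inductive TmD {I : Type} (S : Signature I) : PreCtx I → PreTm I → PreTy I → Type where
  | var {Γ : PreCtx I} {x : ℕ} {A : PreTy I} :
      CtxD S Γ → PreCtx.Mem x A Γ → TmD S Γ (.var x) A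
  | con {Δ : PreCtx I} {i : I} {γ : PreSub I} {A : PreTy I} :
      TyD S ((S.Ci i).lift I) (S.Ti i) → SubD S Δ γ ((S.Ci i).lift I) →
      A = (S.Ti i).subst γ → TmD S Δ (.con i γ) A

/-- Derivation trees of `Δ ⊢ γ : Γ`. -/
inductive SubD {I : Type} (S : Signature I) : PreCtx I → PreSub I → PreCtx I → Type where
  | es {Δ : PreCtx I} : CtxD S Δ → SubD S Δ .nil .nil
  | sc {Δ Γ : PreCtx I} {γ : PreSub I} {x y : ℕ} {A : PreTy I} {t : PreTm I} :
      SubD S Δ γ Γ → CtxD S (Γ.snoc x A) → TmD S Δ t (A.subst γ) → x = y →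
      SubD S Δ (γ.snoc y t) (Γ.snoc x A)
end

/-- The theory `Glob`. -/
def globSig : Signature Empty where
  Ci := fun i => i.elim
  Ti := fun i => i.elim

/-- A globular type theory: the contexts `Ci i` have to be derivable in `Glob`. -/
structure GlobularTT (I : Type) extends Signature I where
  valid : ∀ i, Nonempty (CtxD globSig (Ci i))

namespace Signature

variable {I : Type} (S : Signature I)

/-- Typed contexts, types, terms and substitutions: raw objects with a derivation. -/
abbrev Ctx : Type := Σ Γ : PreCtx I, CtxD S Γ

abbrev Ty (Γ : PreCtx I) : Type := Σ A : PreTy I, TyD S Γ A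

abbrev Tm (Γ : PreCtx I) (A : PreTy I) : Type := Σ t : PreTm I, TmD S Γ t A

abbrev Sub (Δ Γ : PreCtx I) : Type := Σ γ : PreSub I, SubD S Δ γ Γ

end Signature

/-! ### Sphere and disk contexts -/

/-- The universal type of dimension `n`. -/
def univTy (I : Type) : ℕ → PreTy I
  | 0 => .obj
  | n + 1 => .arr (univTy I n) (.var (2 * n)) (.var (2 * n + 1))

/-- The sphere context; the disk context is inlined in the recursion, see `disk`. -/
def sphere (I : Type) : ℕ → PreCtx I
  | 0 => .nil
  | n + 1 =>
    let D := (sphere I n).snoc (sphere I n).length (univTy I n)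
    D.snoc D.length (univTy I n)

/-- The disk context. -/
def disk (I : Type) (n : ℕ) : PreCtx I :=
  (sphere I n).snoc (sphere I n).length (univTy I n)

/-! ### Categories with families -/

/-- The structure of a category with families on given sorts of contexts, substitutions, types and
terms, where `Sub Δ Γ` is the set of morphisms from `Δ` to `Γ`: a category with a terminal object,
a functorial action of its morphisms on types and terms, and a comprehension `Γ, A` that represents
the pairs of a morphism `γ` to `Γ` and a term of type `A[γ]`. -/
structure CwF (Con : Type) (Sub : Con → Con → Type) (Ty : Con → Type)
    (Tm : (Γ : Con) → Ty Γ → Type) where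
  ident : (Γ : Con) → Sub Γ Γ
  comp : {Γ Δ Θ : Con} → Sub Δ Γ → Sub Θ Δ → Sub Θ Γ
  ident_comp : ∀ {Γ Δ : Con} (γ : Sub Δ Γ), comp (ident Γ) γ = γ
  comp_ident : ∀ {Γ Δ : Con} (γ : Sub Δ Γ), comp γ (ident Δ) = γ
  assoc : ∀ {Γ Δ Θ Ξ : Con} (γ : Sub Δ Γ) (δ : Sub Θ Δ) (θ : Sub Ξ Θ),
    comp (comp γ δ) θ = comp γ (comp δ θ)
  empty : Con
  toEmpty : (Γ : Con) → Sub Γ empty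
  toEmpty_unique : ∀ {Γ : Con} (γ : Sub Γ empty), γ = toEmpty Γ
  substTy : {Γ Δ : Con} → Ty Γ → Sub Δ Γ → Ty Δ
  substTy_ident : ∀ {Γ : Con} (A : Ty Γ), substTy A (ident Γ) = A
  substTy_comp : ∀ {Γ Δ Θ : Con} (A : Ty Γ) (γ : Sub Δ Γ) (δ : Sub Θ Δ),
    substTy (substTy A γ) δ = substTy A (comp γ δ)
  substTm : {Γ Δ : Con} → {A : Ty Γ} → Tm Γ A → (γ : Sub Δ Γ) → Tm Δ (substTy A γ)
  substTm_ident : ∀ {Γ : Con} {A : Ty Γ} (t : Tm Γ A), HEq (substTm t (ident Γ)) t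
  substTm_comp : ∀ {Γ Δ Θ : Con} {A : Ty Γ} (t : Tm Γ A) (γ : Sub Δ Γ) (δ : Sub Θ Δ),
    HEq (substTm (substTm t γ) δ) (substTm t (comp γ δ))
  ext : (Γ : Con) → Ty Γ → Con
  proj : {Γ : Con} → (A : Ty Γ) → Sub (ext Γ A) Γ
  last : {Γ : Con} → (A : Ty Γ) → Tm (ext Γ A) (substTy A (proj A))
  pair : {Γ Δ : Con} → {A : Ty Γ} → (γ : Sub Δ Γ) → Tm Δ (substTy A γ) → Sub Δ (ext Γ A)
  proj_pair : ∀ {Γ Δ : Con} {A : Ty Γ} (γ : Sub Δ Γ) (t : Tm Δ (substTy A γ)),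
    comp (proj A) (pair γ t) = γ
  last_pair : ∀ {Γ Δ : Con} {A : Ty Γ} (γ : Sub Δ Γ) (t : Tm Δ (substTy A γ)),
    HEq (substTm (last A) (pair γ t)) t
  pair_unique : ∀ {Γ Δ : Con} {A : Ty Γ} (γ : Sub Δ Γ) (t : Tm Δ (substTy A γ))
    (σ : Sub Δ (ext Γ A)), comp (proj A) σ = γ → HEq (substTm (last A) σ) t → σ = pair γ t

/-! ### Ps-contexts -/

/-- Derivation trees of the auxiliary judgement `Γ ⊢ps x : A`. -/
inductive PsAux : PreCtx Empty → ℕ → PreTy Empty → Type where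
  | pss : PsAux (PreCtx.nil.snoc 0 .obj) 0 .obj
  | psd {Γ : PreCtx Empty} {f x y : ℕ} {A : PreTy Empty} :
      PsAux Γ f (.arr A (.var x) (.var y)) → PsAux Γ y A
  | pse {Γ : PreCtx Empty} {x l : ℕ} {A : PreTy Empty} :
      PsAux Γ x A → l = Γ.length →
      PsAux ((Γ.snoc l A).snoc (l + 1) (.arr A (.var x) (.var l))) (l + 1)
        (.arr A (.var x) (.var l))

/-- Derivation trees of the judgement `Γ ⊢ps`. -/
inductive Ps : PreCtx Empty → Type where
  | ps {Γ : PreCtx Empty} {x : ℕ} : PsAux Γ x .obj → Ps Γ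

/-- The list of variables of the `i`-source; the last variable of the context comes first. -/
def PsAux.src (i : ℕ) : {Γ : PreCtx Empty} → {x : ℕ} → {A : PreTy Empty} → PsAux Γ x A → List ℕ
  | _, _, _, .pss => if i = 0 then [] else [0]
  | _, _, _, .psd d => d.src i
  | _, _, _, .pse (l := l) (A := A) d _ =>
    if i ≤ A.dim + 1 then d.src i else (l + 1) :: l :: d.src i

/-- The list of variables of the `i`-target; the last variable of the context comes first. -/
def PsAux.tgt (i : ℕ) : {Γ : PreCtx Empty} → {x : ℕ} → {A : PreTy Empty} → PsAux Γ x A → List ℕ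
  | _, _, _, .pss => if i = 0 then [] else [0]
  | _, _, _, .psd d => d.tgt i
  | _, _, _, .pse (l := l) (A := A) d _ =>
    if i ≤ A.dim + 1 then
      (if i = A.dim + 1 then l :: (d.tgt i).tail else d.tgt i)
    else (l + 1) :: l :: d.tgt i

/-- Ps-contexts. -/
structure PsCtx : Type where
  ctx : PreCtx Empty
  ps : Ps ctx

/-- The set of source variables of a ps-context. -/
def PsCtx.src : PsCtx → Finset ℕ
  | ⟨Γ, .ps d⟩ => (d.src Γ.dim).toFinset

/-- The set of target variables of a ps-context. -/
def PsCtx.tgt : PsCtx → Finset ℕ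
  | ⟨Γ, .ps d⟩ => (d.tgt Γ.dim).toFinset

/-- A type is full in a ps-context if it satisfies one of the two side conditions of the term
constructors of `CaTT`. -/
inductive PreTy.FullIn {I : Type} : PreTy I → PsCtx → Prop where
  | op {Γ : PsCtx} {A : PreTy I} {t u : PreTm I} :
      Γ.src = A.vars ∪ t.vars → Γ.tgt = A.vars ∪ u.vars → (PreTy.arr A t u).FullIn Γ
  | coh {Γ : PsCtx} {A : PreTy I} : Γ.ctx.vars = A.vars → A.FullIn Γ

/-! ### The index type of `CaTT`

The index type `J` is to be the type of pairs of a ps-context `Γ` and a raw type `A` over `J` that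
is full in `Γ`. It is the least solution of this recursive equation. To obtain it, consider first
the syntax where the pairs are not required to be full, and then select the objects all of whose
constructors, at every depth, satisfy this requirement. `J.equiv` below is the equation. -/

mutual
inductive CohTy : Type where
  | obj : CohTy
  | arr : CohTy → CohTm → CohTm → CohTy

inductive CohTm : Type where
  | var : ℕ → CohTm
  | con : PsCtx → CohTy → CohSub → CohTm

inductive CohSub : Type where
  | nil : CohSub
  | snoc : CohSub → ℕ → CohTm → CohSub
end

mutual
def CohTy.vars : CohTy → Finset ℕ
  | .obj => ∅
  | .arr A t u => A.vars ∪ t.vars ∪ u.vars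

def CohTm.vars : CohTm → Finset ℕ
  | .var x => {x}
  | .con _ _ γ => γ.vars

def CohSub.vars : CohSub → Finset ℕ
  | .nil => ∅
  | .snoc γ _ t => γ.vars ∪ t.vars
end

inductive CohTy.FullIn : CohTy → PsCtx → Prop where
  | op {Γ : PsCtx} {A : CohTy} {t u : CohTm} :
      Γ.src = A.vars ∪ t.vars → Γ.tgt = A.vars ∪ u.vars → (CohTy.arr A t u).FullIn Γ
  | coh {Γ : PsCtx} {A : CohTy} : Γ.ctx.vars = A.vars → A.FullIn Γ

mutual
/-- All the indices that occur in the type, at any depth, are full. -/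
def CohTy.Good : CohTy → Prop
  | .obj => True
  | .arr A t u => A.Good ∧ t.Good ∧ u.Good

def CohTm.Good : CohTm → Prop
  | .var _ => True
  | .con Γ A γ => (A.Good ∧ A.FullIn Γ) ∧ γ.Good

def CohSub.Good : CohSub → Prop
  | .nil => True
  | .snoc γ _ t => γ.Good ∧ t.Good
end

/-- The index type of the term constructors of `CaTT`. -/
structure J : Type where
  ctx : PsCtx
  ty : CohTy
  good : ty.Good ∧ ty.FullIn ctx

mutual
/-- The raw type over `J` given by a type all of whose indices are full. -/
def CohTy.toPre : (A : CohTy) → A.Good → PreTy J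
  | .obj, _ => .obj
  | .arr A t u, h => .arr (A.toPre h.1) (t.toPre h.2.1) (u.toPre h.2.2)

def CohTm.toPre : (t : CohTm) → t.Good → PreTm J
  | .var x, _ => .var x
  | .con Γ A γ, h => .con ⟨Γ, A, h.1⟩ (γ.toPre h.2)

def CohSub.toPre : (γ : CohSub) → γ.Good → PreSub J
  | .nil, _ => .nil
  | .snoc γ x t, h => .snoc (γ.toPre h.1) x (t.toPre h.2)
end

mutual
def PreTy.toCoh : PreTy J → CohTy
  | .obj => .obj
  | .arr A t u => .arr A.toCoh t.toCoh u.toCoh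

def PreTm.toCoh : PreTm J → CohTm
  | .var x => .var x
  | .con j γ => .con j.ctx j.ty γ.toCoh

def PreSub.toCoh : PreSub J → CohSub
  | .nil => .nil
  | .snoc γ x t => .snoc γ.toCoh x t.toCoh
end

mutual
theorem PreTy.toCoh_good : ∀ A : PreTy J, A.toCoh.Good
  | .obj => trivial
  | .arr A t u => ⟨A.toCoh_good, t.toCoh_good, u.toCoh_good⟩

theorem PreTm.toCoh_good : ∀ t : PreTm J, t.toCoh.Good
  | .var _ => trivial
  | .con j γ => ⟨j.good, γ.toCoh_good⟩

theorem PreSub.toCoh_good : ∀ γ : PreSub J, γ.toCoh.Good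
  | .nil => trivial
  | .snoc γ _ t => ⟨γ.toCoh_good, t.toCoh_good⟩
end

mutual
theorem PreTy.toPre_toCoh : ∀ (A : PreTy J) (h : A.toCoh.Good), A.toCoh.toPre h = A
  | .obj, _ => rfl
  | .arr A t u, h => by
    simp only [PreTy.toCoh, CohTy.toPre]
    rw [A.toPre_toCoh h.1, t.toPre_toCoh h.2.1, u.toPre_toCoh h.2.2]

theorem PreTm.toPre_toCoh : ∀ (t : PreTm J) (h : t.toCoh.Good), t.toCoh.toPre h = t
  | .var _, _ => rfl
  | .con j γ, h => by
    simp only [PreTm.toCoh, CohTm.toPre]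
    rw [γ.toPre_toCoh h.2]

theorem PreSub.toPre_toCoh : ∀ (γ : PreSub J) (h : γ.toCoh.Good), γ.toCoh.toPre h = γ
  | .nil, _ => rfl
  | .snoc γ x t, h => by
    simp only [PreSub.toCoh, CohSub.toPre]
    rw [γ.toPre_toCoh h.1, t.toPre_toCoh h.2]
end

mutual
theorem CohTy.toCoh_toPre : ∀ (A : CohTy) (h : A.Good), (A.toPre h).toCoh = A
  | .obj, _ => rfl
  | .arr A t u, h => by
    simp only [PreTy.toCoh, CohTy.toPre]
    rw [A.toCoh_toPre h.1, t.toCoh_toPre h.2.1, u.toCoh_toPre h.2.2]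

theorem CohTm.toCoh_toPre : ∀ (t : CohTm) (h : t.Good), (t.toPre h).toCoh = t
  | .var _, _ => rfl
  | .con Γ A γ, h => by
    simp only [PreTm.toCoh, CohTm.toPre]
    rw [γ.toCoh_toPre h.2]

theorem CohSub.toCoh_toPre : ∀ (γ : CohSub) (h : γ.Good), (γ.toPre h).toCoh = γ
  | .nil, _ => rfl
  | .snoc γ x t, h => by
    simp only [PreSub.toCoh, CohSub.toPre]
    rw [γ.toCoh_toPre h.1, t.toCoh_toPre h.2]
end

mutual
theorem PreTy.vars_toCoh : ∀ A : PreTy J, A.toCoh.vars = A.vars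
  | .obj => rfl
  | .arr A t u => by
    simp only [PreTy.toCoh, CohTy.vars, PreTy.vars]
    rw [A.vars_toCoh, t.vars_toCoh, u.vars_toCoh]

theorem PreTm.vars_toCoh : ∀ t : PreTm J, t.toCoh.vars = t.vars
  | .var _ => rfl
  | .con j γ => by
    simp only [PreTm.toCoh, CohTm.vars, PreTm.vars]
    rw [γ.vars_toCoh]

theorem PreSub.vars_toCoh : ∀ γ : PreSub J, γ.toCoh.vars = γ.vars
  | .nil => rfl
  | .snoc γ x t => by
    simp only [PreSub.toCoh, CohSub.vars, PreSub.vars]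
    rw [γ.vars_toCoh, t.vars_toCoh]
end

theorem PreTy.fullIn_toCoh (A : PreTy J) (Γ : PsCtx) : A.toCoh.FullIn Γ ↔ A.FullIn Γ := by
  constructor
  · intro h
    cases A with
    | obj =>
      cases h with
      | coh h => exact .coh (by rw [h, PreTy.vars_toCoh])
    | arr A t u =>
      cases h with
      | op h h' =>
        exact .op (by rw [h, PreTy.vars_toCoh, PreTm.vars_toCoh])
          (by rw [h', PreTy.vars_toCoh, PreTm.vars_toCoh])
      | coh h =>
        exact .coh (h.trans (PreTy.vars_toCoh (.arr A t u)))
  · intro h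
    cases h with
    | op h h' =>
      exact .op (by rw [h, PreTy.vars_toCoh, PreTm.vars_toCoh])
        (by rw [h', PreTy.vars_toCoh, PreTm.vars_toCoh])
    | coh h => exact .coh (by rw [h, PreTy.vars_toCoh])

/-- The context and the type of an index. -/
def J.ci (j : J) : PreCtx Empty := j.ctx.ctx

def J.ti (j : J) : PreTy J := j.ty.toPre j.good.1

/-- An index is the same as a ps-context `Γ` with a raw type over `J` that is full in `Γ`. -/
def J.equiv : J ≃ {p : PsCtx × PreTy J // p.2.FullIn p.1} where
  toFun j := ⟨(j.ctx, j.ti), by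
    have h := j.good.2
    rw [← j.ty.toCoh_toPre j.good.1, PreTy.fullIn_toCoh] at h
    exact h⟩
  invFun p := ⟨p.1.1, p.1.2.toCoh, p.1.2.toCoh_good, (p.1.2.fullIn_toCoh p.1.1).2 p.2⟩
  left_inv j := by
    obtain ⟨Γ, A, h⟩ := j
    simp only [J.ti, CohTy.toCoh_toPre]
  right_inv p := by
    obtain ⟨⟨Γ, A⟩, h⟩ := p
    simp only [J.ti, PreTy.toPre_toCoh]

/-! ### The theory `CaTT`

Its contexts `Ci j` are ps-contexts, and these are derivable in `Glob`. -/

def globWkTm {Γ : PreCtx Empty} {t : PreTm Empty} {A B : PreTy Empty} {y : ℕ}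
    (d : TmD globSig Γ t A) (e : CtxD globSig (Γ.snoc y B)) : TmD globSig (Γ.snoc y B) t A :=
  match t, d with
  | .var _, .var _ m => .var e (.there m)
  | .con i _, _ => i.elim

def globWkTy {Γ : PreCtx Empty} {A B : PreTy Empty} {y : ℕ}
    (d : TyD globSig Γ A) (e : CtxD globSig (Γ.snoc y B)) : TyD globSig (Γ.snoc y B) A :=
  match A, d with
  | .obj, _ => .ob e
  | .arr _ _ _, .ar d d' => .ar (globWkTm d e) (globWkTm d' e)

def globMemTy {x : ℕ} {A : PreTy Empty} : {Γ : PreCtx Empty} →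
    CtxD globSig Γ → PreCtx.Mem x A Γ → TyD globSig Γ A
  | _, .cc c d h, .here => globWkTy d (.cc c d h)
  | _, .cc c d h, .there m => globWkTy (globMemTy c m) (.cc c d h)

def globTmTy {Γ : PreCtx Empty} {t : PreTm Empty} {A : PreTy Empty}
    (d : TmD globSig Γ t A) : TyD globSig Γ A :=
  match t, d with
  | .var _, .var c m => globMemTy c m
  | .con i _, _ => i.elim

def PsAux.valid : {Γ : PreCtx Empty} → {x : ℕ} → {A : PreTy Empty} → PsAux Γ x A →
    CtxD globSig Γ × TmD globSig Γ (.var x) A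
  | _, _, _, .pss =>
    let c : CtxD globSig (PreCtx.nil.snoc 0 .obj) := .cc .ec (.ob .ec) rfl
    (c, .var c .here)
  | _, _, _, .psd d =>
    match d.valid with
    | (c, m) =>
      match globTmTy m with
      | .ar _ e => (c, e)
  | _, _, _, .pse d h =>
    match d.valid with
    | (c, m) =>
      let c' := CtxD.cc c (globTmTy m) h
      let c'' := CtxD.cc c' (.ar (globWkTm m c') (.var c' .here)) (by rw [h]; rfl)
      (c'', .var c'' .here)

theorem Ps.valid {Γ : PreCtx Empty} : Ps Γ → Nonempty (CtxD globSig Γ)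
  | .ps d => ⟨d.valid.1⟩

/-- The theory `CaTT`. -/
def CaTT : GlobularTT J where
  Ci := J.ci
  Ti := J.ti
  valid j := j.ctx.ps.valid

/-! ### Gödel numbers

The raw syntax of `CaTT` consists of finite expressions, which are numbered in the usual way, so that
decidability can be expressed by computability of sets of numbers. The number of a constructor
records its ps-context and its type. -/

section Codes

variable {I : Type}

mutual
/-- The number of a type, for a given numbering of the indices. -/
def PreTy.code (c : I → ℕ) : PreTy I → ℕ
  | .obj => 0
  | .arr A t u => Nat.pair (A.code c) (Nat.pair (t.code c) (u.code c)) + 1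

def PreTm.code (c : I → ℕ) : PreTm I → ℕ
  | .var x => 2 * x
  | .con i γ => 2 * Nat.pair (c i) (γ.code c) + 1

def PreSub.code (c : I → ℕ) : PreSub I → ℕ
  | .nil => 0
  | .snoc γ x t => Nat.pair (γ.code c) (Nat.pair x (t.code c)) + 1
end

def PreCtx.code (c : I → ℕ) : PreCtx I → ℕ
  | .nil => 0
  | .snoc Γ x A => Nat.pair (Γ.code c) (Nat.pair x (A.code c)) + 1

end Codes

/-- The number of a ps-context. -/
def PsCtx.code (Γ : PsCtx) : ℕ := Γ.ctx.code fun i => i.elim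

mutual
def CohTy.code : CohTy → ℕ
  | .obj => 0
  | .arr A t u => Nat.pair A.code (Nat.pair t.code u.code) + 1

def CohTm.code : CohTm → ℕ
  | .var x => 2 * x
  | .con Γ A γ => 2 * Nat.pair (Nat.pair Γ.code A.code) γ.code + 1

def CohSub.code : CohSub → ℕ
  | .nil => 0
  | .snoc γ x t => Nat.pair γ.code (Nat.pair x t.code) + 1
end

/-- The number of an index of `CaTT`. -/
def J.code (j : J) : ℕ := Nat.pair j.ctx.code j.ty.code

/-!
The theory is treated for an arbitrary signature as far as possible; only the numbering uses `CaTT`.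

*Structure.* Weakening leaves the raw objects unchanged. Composition of raw substitutions is
functorial only on objects whose variables lie in the domain (`PreTy.subst_comp`), and this is the
case for derivable objects, whose variables are declared by their context (`TyD.vars_subset`).
Therefore substitution preserves derivability (`TyD.subst`), and `T[γ]` is derivable for each
constructor term. In a derivable context all variables are distinct, so that lookups of variables are
unique; all rules are directed by their conclusion, and derivations are unique (`CtxD.unique`). The
equations of the category with families (`Signature.cwf`) thus reduce to equations of raw syntax.

*Ps-contexts.* A derivation of `Γ ⊢ps x : A` is a step `pss` or `pse`, which is fixed by `Γ`,
followed by steps `psd`, each of which lowers the dimension of the type by one. So `Γ` and the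
dimension of `A` determine it (`PsAux.sigma_unique`).

*Spheres.* A substitution to the sphere of dimension `n + 1` is a substitution to the sphere of
dimension `n` with two parallel terms, just as an arrow type is a type with two terms of this type
(`sphereEquiv`).

*Decidability.* A judgement is derivable if and only if a side condition and finitely many premises
hold, both of which are computed from the judgement (`Code.derivable_iff`). All premises have a
smaller size (`Code.size_lt_of_mem_premises`): the subjects become smaller, a constructor term has a
larger number than the context and the type of its constructor, and the type `A` in `Γ ⊢ t : A`,
which may grow by substitution, is not counted. Since the side conditions and the premises are
primitive recursive in the numbers, so is derivability (`Code.primrecPred_derivable`). The side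
conditions include the recognition of raw expressions (`Code.isSyn_iff`) and thereby of ps-contexts
(`Code.isPs_iff`) and full types (`Code.full_code`).
-/

/-! ### Raw substitution calculus -/

section Raw

variable {I : Type}

/-- The set of variables that a substitution assigns a term to. -/
def PreSub.dom : PreSub I → Finset ℕ
  | .nil => ∅
  | .snoc γ x _ => γ.dom ∪ {x}

theorem PreSub.lookup_ident : ∀ (Γ : PreCtx I) (x : ℕ), (PreSub.ident Γ).lookup x = .var x
  | .nil, _ => rfl
  | .snoc Γ y _, x => by
    simp only [PreSub.ident, PreSub.lookup, PreSub.lookup_ident Γ x]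
    split <;> simp_all

mutual
theorem PreTy.subst_ident (Γ : PreCtx I) : ∀ A : PreTy I, A.subst (PreSub.ident Γ) = A
  | .obj => rfl
  | .arr A t u => by
    simp only [PreTy.subst, PreTy.subst_ident Γ A, PreTm.subst_ident Γ t, PreTm.subst_ident Γ u]

theorem PreTm.subst_ident (Γ : PreCtx I) : ∀ t : PreTm I, t.subst (PreSub.ident Γ) = t
  | .var x => PreSub.lookup_ident Γ x
  | .con i γ => by simp only [PreTm.subst, PreSub.comp_ident Γ γ]

theorem PreSub.comp_ident (Γ : PreCtx I) : ∀ γ : PreSub I, γ.comp (PreSub.ident Γ) = γ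
  | .nil => rfl
  | .snoc γ x t => by simp only [PreSub.comp, PreSub.comp_ident Γ γ, PreTm.subst_ident Γ t]
end

theorem PreSub.lookup_comp {x : ℕ} (δ : PreSub I) :
    ∀ γ : PreSub I, x ∈ γ.dom → (γ.lookup x).subst δ = (γ.comp δ).lookup x
  | .nil, h => by simp [PreSub.dom] at h
  | .snoc γ y t, h => by
    simp only [PreSub.dom, Finset.mem_union, Finset.mem_singleton] at h
    simp only [PreSub.lookup, PreSub.comp]
    split
    · rfl
    · exact PreSub.lookup_comp δ γ (h.resolve_right ‹_›)

mutual
/-- Functoriality of the action on types. The hypothesis cannot be dropped: a variable outside the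
domain of `γ` is left alone by `γ ∘ δ`, but not by `γ` followed by `δ`. -/
theorem PreTy.subst_comp (γ δ : PreSub I) :
    ∀ A : PreTy I, A.vars ⊆ γ.dom → (A.subst γ).subst δ = A.subst (γ.comp δ)
  | .obj, _ => rfl
  | .arr A t u, h => by
    simp only [PreTy.vars, Finset.union_subset_iff] at h
    simp only [PreTy.subst, PreTy.subst_comp γ δ A h.1.1, PreTm.subst_comp γ δ t h.1.2,
      PreTm.subst_comp γ δ u h.2]

theorem PreTm.subst_comp (γ δ : PreSub I) :
    ∀ t : PreTm I, t.vars ⊆ γ.dom → (t.subst γ).subst δ = t.subst (γ.comp δ)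
  | .var x, h => PreSub.lookup_comp δ γ (by simpa [PreTm.vars] using h)
  | .con i θ, h => by
    simp only [PreTm.vars] at h
    simp only [PreTm.subst, PreSub.comp_assoc γ δ θ h]

theorem PreSub.comp_assoc (γ δ : PreSub I) :
    ∀ θ : PreSub I, θ.vars ⊆ γ.dom → (θ.comp γ).comp δ = θ.comp (γ.comp δ)
  | .nil, _ => rfl
  | .snoc θ x t, h => by
    simp only [PreSub.vars, Finset.union_subset_iff] at h
    simp only [PreSub.comp, PreSub.comp_assoc γ δ θ h.1, PreTm.subst_comp γ δ t h.2]
end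

mutual
theorem PreTy.subst_snoc (γ : PreSub I) {y : ℕ} (s : PreTm I) :
    ∀ A : PreTy I, y ∉ A.vars → A.subst (γ.snoc y s) = A.subst γ
  | .obj, _ => rfl
  | .arr A t u, h => by
    simp only [PreTy.vars, Finset.mem_union, not_or] at h
    simp only [PreTy.subst, PreTy.subst_snoc γ s A h.1.1, PreTm.subst_snoc γ s t h.1.2,
      PreTm.subst_snoc γ s u h.2]

theorem PreTm.subst_snoc (γ : PreSub I) {y : ℕ} (s : PreTm I) :
    ∀ t : PreTm I, y ∉ t.vars → t.subst (γ.snoc y s) = t.subst γ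
  | .var x, h => by
    have h' : x ≠ y := fun e => h (by simp [PreTm.vars, e])
    simp [PreTm.subst, PreSub.lookup, h']
  | .con i θ, h => by
    simp only [PreTm.vars] at h
    simp only [PreTm.subst, PreSub.comp_snoc γ s θ h]

theorem PreSub.comp_snoc (γ : PreSub I) {y : ℕ} (s : PreTm I) :
    ∀ θ : PreSub I, y ∉ θ.vars → θ.comp (γ.snoc y s) = θ.comp γ
  | .nil, _ => rfl
  | .snoc θ x t, h => by
    simp only [PreSub.vars, Finset.mem_union, not_or] at h
    simp only [PreSub.comp, PreSub.comp_snoc γ s θ h.1, PreTm.subst_snoc γ s t h.2]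
end

theorem PreSub.vars_ident : ∀ Γ : PreCtx I, (PreSub.ident Γ).vars = Γ.vars
  | .nil => rfl
  | .snoc Γ x _ => by
    simp only [PreSub.ident, PreSub.vars, PreTm.vars, PreCtx.vars, PreSub.vars_ident Γ]

theorem PreTy.dim_subst (γ : PreSub I) : ∀ A : PreTy I, (A.subst γ).dim = A.dim
  | .obj => rfl
  | .arr A _ _ => by simp only [PreTy.subst, PreTy.dim, PreTy.dim_subst γ A]

theorem PreCtx.Mem.mem_vars {x : ℕ} {A : PreTy I} : {Γ : PreCtx I} → Mem x A Γ → x ∈ Γ.vars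
  | _, .here => by simp [PreCtx.vars]
  | _, .there m => by simp [PreCtx.vars, m.mem_vars]

end Raw

/-! ### Structural properties of the derivable judgements -/

section Structural

variable {I : Type} {S : Signature I}

mutual
/-- Weakening. Nothing changes in the raw objects, since variables are named by their position
counted from the start of the context. -/
def TyD.weaken {Γ : PreCtx I} {A B : PreTy I} {y : ℕ} :
    TyD S Γ A → CtxD S (Γ.snoc y B) → TyD S (Γ.snoc y B) A
  | .ob _, e => .ob e
  | .ar d d', e => .ar (d.weaken e) (d'.weaken e)

def TmD.weaken {Γ : PreCtx I} {t : PreTm I} {A B : PreTy I} {y : ℕ} :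
    TmD S Γ t A → CtxD S (Γ.snoc y B) → TmD S (Γ.snoc y B) t A
  | .var _ m, e => .var e (.there m)
  | .con d g h, e => .con d (g.weaken e) h

def SubD.weaken {Δ Γ : PreCtx I} {γ : PreSub I} {B : PreTy I} {y : ℕ} :
    SubD S Δ γ Γ → CtxD S (Δ.snoc y B) → SubD S (Δ.snoc y B) γ Γ
  | .es _, e => .es e
  | .sc g c d h, e => .sc (g.weaken e) c (d.weaken e) h
end

/-- The domain of a derivable substitution is derivable. -/
def SubD.source {Δ Γ : PreCtx I} {γ : PreSub I} : SubD S Δ γ Γ → CtxD S Δ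
  | .es c => c
  | .sc g _ _ _ => g.source

/-- The codomain of a derivable substitution is derivable. -/
def SubD.target {Δ Γ : PreCtx I} {γ : PreSub I} : SubD S Δ γ Γ → CtxD S Γ
  | .es _ => .ec
  | .sc _ c _ _ => c

/-- The context of a derivable term is derivable. -/
def TmD.ctx {Γ : PreCtx I} {t : PreTm I} {A : PreTy I} : TmD S Γ t A → CtxD S Γ
  | .var c _ => c
  | .con _ g _ => g.source

/-- The context of a derivable type is derivable. -/
def TyD.ctx {Γ : PreCtx I} {A : PreTy I} : TyD S Γ A → CtxD S Γ
  | .ob c => c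
  | .ar d _ => d.ctx

theorem SubD.dom_eq {Δ Γ : PreCtx I} {γ : PreSub I} : SubD S Δ γ Γ → γ.dom = Γ.vars
  | .es _ => rfl
  | .sc g _ _ h => by simp only [PreSub.dom, PreCtx.vars, g.dom_eq, h]

theorem PreSub.vars_lookup_subset {x : ℕ} :
    ∀ γ : PreSub I, x ∈ γ.dom → (γ.lookup x).vars ⊆ γ.vars
  | .nil, h => by simp [PreSub.dom] at h
  | .snoc γ y t, h => by
    simp only [PreSub.dom, Finset.mem_union, Finset.mem_singleton] at h
    simp only [PreSub.lookup, PreSub.vars]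
    split
    · exact Finset.subset_union_right
    · exact (PreSub.vars_lookup_subset γ (h.resolve_right ‹_›)).trans Finset.subset_union_left

mutual
theorem PreTy.vars_subst_subset (γ : PreSub I) :
    ∀ A : PreTy I, A.vars ⊆ γ.dom → (A.subst γ).vars ⊆ γ.vars
  | .obj, _ => by simp [PreTy.subst, PreTy.vars]
  | .arr A t u, h => by
    simp only [PreTy.subst, PreTy.vars, Finset.union_subset_iff] at h ⊢
    exact ⟨⟨A.vars_subst_subset γ h.1.1, t.vars_subst_subset γ h.1.2⟩, u.vars_subst_subset γ h.2⟩

theorem PreTm.vars_subst_subset (γ : PreSub I) :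
    ∀ t : PreTm I, t.vars ⊆ γ.dom → (t.subst γ).vars ⊆ γ.vars
  | .var x, h => γ.vars_lookup_subset (by simpa [PreTm.vars] using h)
  | .con i θ, h => PreSub.vars_comp_subset γ θ h

theorem PreSub.vars_comp_subset (γ : PreSub I) :
    ∀ θ : PreSub I, θ.vars ⊆ γ.dom → (θ.comp γ).vars ⊆ γ.vars
  | .nil, _ => by simp [PreSub.comp, PreSub.vars]
  | .snoc θ x t, h => by
    simp only [PreSub.comp, PreSub.vars, Finset.union_subset_iff] at h ⊢
    exact ⟨PreSub.vars_comp_subset γ θ h.1, t.vars_subst_subset γ h.2⟩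
end

mutual
/-- The variables of a derivable object are declared by its context; in the case of types, this
involves the types of the terms in them, hence the context. -/
theorem CtxD.vars_mem_subset {Γ : PreCtx I} {x : ℕ} {A : PreTy I} :
    CtxD S Γ → PreCtx.Mem x A Γ → A.vars ⊆ Γ.vars
  | .cc _ d _, .here => d.vars_subset.trans Finset.subset_union_left
  | .cc c _ _, .there m => (c.vars_mem_subset m).trans Finset.subset_union_left

theorem TyD.vars_subset {Γ : PreCtx I} {A : PreTy I} : TyD S Γ A → A.vars ⊆ Γ.vars
  | .ob _ => by simp [PreTy.vars]
  | .ar d d' => by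
    simp only [PreTy.vars, Finset.union_subset_iff]
    exact ⟨⟨d.vars_subset.2, d.vars_subset.1⟩, d'.vars_subset.1⟩

theorem TmD.vars_subset {Γ : PreCtx I} {t : PreTm I} {A : PreTy I} :
    TmD S Γ t A → t.vars ⊆ Γ.vars ∧ A.vars ⊆ Γ.vars
  | .var c m => ⟨by simpa [PreTm.vars] using m.mem_vars, c.vars_mem_subset m⟩
  | .con (γ := γ) d g h => by
    refine ⟨g.vars_subset, ?_⟩
    rw [h]
    exact (PreTy.vars_subst_subset γ _ (g.dom_eq ▸ d.vars_subset)).trans g.vars_subset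

theorem SubD.vars_subset {Δ Γ : PreCtx I} {γ : PreSub I} : SubD S Δ γ Γ → γ.vars ⊆ Δ.vars
  | .es _ => by simp [PreSub.vars]
  | .sc g _ d _ => Finset.union_subset g.vars_subset d.vars_subset.1
end

theorem CtxD.vars_eq {Γ : PreCtx I} : CtxD S Γ → Γ.vars = Finset.range Γ.length
  | .ec => rfl
  | .cc c _ h => by
    rw [PreCtx.vars, c.vars_eq, h, PreCtx.length, Finset.range_add_one, Finset.insert_eq,
      Finset.union_comm]

theorem CtxD.notMem_vars {Γ : PreCtx I} {x : ℕ} {A : PreTy I} (c : CtxD S (Γ.snoc x A)) :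
    x ∉ Γ.vars := by
  cases c with
  | cc c d h => simp [c.vars_eq, h]

theorem CtxD.vars_last_subset {Γ : PreCtx I} {x : ℕ} {A : PreTy I} :
    CtxD S (Γ.snoc x A) → A.vars ⊆ Γ.vars
  | .cc _ d _ => d.vars_subset

/-- An initial segment of a derivable context is derivable. -/
def CtxD.tail {Γ : PreCtx I} {x : ℕ} {A : PreTy I} : CtxD S (Γ.snoc x A) → CtxD S Γ
  | .cc c _ _ => c

/-- The types in a derivable context are derivable over the whole context. -/
def CtxD.mem {x : ℕ} {A : PreTy I} : {Γ : PreCtx I} →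
    CtxD S Γ → PreCtx.Mem x A Γ → TyD S Γ A
  | _, .cc c d h, .here => d.weaken (.cc c d h)
  | _, .cc c d h, .there m => (c.mem m).weaken (.cc c d h)

/-- A derivable substitution sends the variables to terms of the substituted types. Later entries of
the substitution do not interfere, since the variables of a derivable context are distinct. -/
def SubD.lookup {Δ : PreCtx I} {x : ℕ} {A : PreTy I} : {Γ : PreCtx I} → {γ : PreSub I} →
    SubD S Δ γ Γ → PreCtx.Mem x A Γ → TmD S Δ (γ.lookup x) (A.subst γ)
  | _, _, .sc (γ := γ) (t := t) g c d e, .here => by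
    subst e
    rw [PreTy.subst_snoc γ t A fun h => c.notMem_vars (c.vars_last_subset h)]
    simpa only [PreSub.lookup, if_true] using d
  | _, _, .sc (x := z) (γ := γ) (t := t) g c d e, .there m => by
    subst e
    have hx : x ≠ z := fun h => c.notMem_vars (h ▸ m.mem_vars)
    rw [PreTy.subst_snoc γ t A fun h => c.notMem_vars (c.tail.vars_mem_subset m h)]
    simpa only [PreSub.lookup, if_neg hx] using g.lookup m

mutual
/-- Derivable substitutions act on derivable types, and likewise on terms and substitutions below.
Functoriality applies because a derivable object only uses the variables of its context. -/
def TyD.subst {Δ Γ : PreCtx I} {A : PreTy I} {δ : PreSub I} :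
    TyD S Γ A → SubD S Δ δ Γ → TyD S Δ (A.subst δ)
  | .ob _, s => .ob s.source
  | .ar d d', s => .ar (d.subst s) (d'.subst s)

def TmD.subst {Δ Γ : PreCtx I} {t : PreTm I} {A : PreTy I} {δ : PreSub I} :
    TmD S Γ t A → SubD S Δ δ Γ → TmD S Δ (t.subst δ) (A.subst δ)
  | .var _ m, s => s.lookup m
  | .con d g h, s => .con d (g.comp s)
      (by rw [h, PreTy.subst_comp _ _ _ (g.dom_eq ▸ d.vars_subset)])

def SubD.comp {Δ Γ Θ : PreCtx I} {γ δ : PreSub I} :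
    SubD S Γ γ Θ → SubD S Δ δ Γ → SubD S Δ (γ.comp δ) Θ
  | .es _, s => .es s.source
  | .sc g c d h, s => .sc (g.comp s) c
      (PreTy.subst_comp _ _ _ (g.dom_eq ▸ c.vars_last_subset) ▸ d.subst s) h
end

/-- The type of a derivable term is derivable. -/
def TmD.ty {Γ : PreCtx I} {t : PreTm I} {A : PreTy I} : TmD S Γ t A → TyD S Γ A
  | .var c m => c.mem m
  | .con d g h => h ▸ d.subst g

/-- A derivable context has a derivable identity, which weakens to the projections. -/
def CtxD.ident : {Γ : PreCtx I} → CtxD S Γ → SubD S Γ (PreSub.ident Γ) Γ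
  | _, .ec => .es .ec
  | _, .cc c d h =>
    .sc (c.ident.weaken (.cc c d h)) (.cc c d h)
      (by rw [PreTy.subst_ident]; exact .var (.cc c d h) .here) rfl

theorem SubD.ident_comp {Δ : PreCtx I} : {Γ : PreCtx I} → {γ : PreSub I} →
    SubD S Δ γ Γ → (PreSub.ident Γ).comp γ = γ
  | _, _, .es _ => rfl
  | _, _, .sc (γ := γ) (t := t) g c _ h => by
    subst h
    simp only [PreSub.ident, PreSub.comp, PreTm.subst, PreSub.lookup, if_true]
    rw [PreSub.comp_snoc γ t _ fun h => c.notMem_vars (PreSub.vars_ident _ ▸ h), g.ident_comp]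

end Structural

/-! ### Uniqueness of derivations -/

section Uniqueness

variable {I : Type} {S : Signature I}

/-- The declaration of a variable in a derivable context is unique, as no variable is declared
twice. -/
theorem CtxD.mem_unique {x : ℕ} {A : PreTy I} : {Γ : PreCtx I} → CtxD S Γ →
    ∀ m m' : PreCtx.Mem x A Γ, m = m'
  | _, _, .here, .here => rfl
  | _, c, .here, .there m => (c.notMem_vars m.mem_vars).elim
  | _, c, .there m, .here => (c.notMem_vars m.mem_vars).elim
  | _, c, .there m, .there m' => congrArg _ (c.tail.mem_unique m m')

mutual
/-- Each raw object determines the last rule of its derivations and the premises of this rule, except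
for the declaration of a variable in the context, which is unique by `CtxD.mem_unique`. -/
theorem CtxD.unique {Γ : PreCtx I} : ∀ d d' : CtxD S Γ, d = d'
  | .ec, .ec => rfl
  | .cc c d _, .cc c' d' _ => by rw [c.unique c', d.unique d']
termination_by structural d => d

theorem TyD.unique {Γ : PreCtx I} {A : PreTy I} : ∀ d d' : TyD S Γ A, d = d'
  | .ob c, .ob c' => by rw [c.unique c']
  | .ar d e, .ar d' e' => by rw [d.unique d', e.unique e']
termination_by structural d => d

theorem TmD.unique {Γ : PreCtx I} {t : PreTm I} {A : PreTy I} : ∀ d d' : TmD S Γ t A, d = d'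
  | .var c m, .var c' m' => by rw [c.unique c', c.mem_unique m m']
  | .con d g _, .con d' g' _ => by rw [d.unique d', g.unique g']
termination_by structural d => d

theorem SubD.unique {Δ Γ : PreCtx I} {γ : PreSub I} : ∀ d d' : SubD S Δ γ Γ, d = d'
  | .es c, .es c' => by rw [c.unique c']
  | .sc g c d _, .sc g' c' d' _ => by rw [g.unique g', c.unique c', d.unique d']
termination_by structural d => d
end

instance (Γ : PreCtx I) : Subsingleton (CtxD S Γ) := ⟨CtxD.unique⟩
instance (Γ : PreCtx I) (A : PreTy I) : Subsingleton (TyD S Γ A) := ⟨TyD.unique⟩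
instance (Γ : PreCtx I) (t : PreTm I) (A : PreTy I) : Subsingleton (TmD S Γ t A) := ⟨TmD.unique⟩
instance (Δ Γ : PreCtx I) (γ : PreSub I) : Subsingleton (SubD S Δ γ Γ) := ⟨SubD.unique⟩

/-- The type of the last variable of a ps-context has the largest dimension among the types of the
variables that its derivation passes through. -/
theorem PsAux.dim_le {Γ : PreCtx Empty} {x y : ℕ} {A B : PreTy Empty} :
    PsAux (Γ.snoc y B) x A → A.dim ≤ B.dim
  | .pss => le_rfl
  | .psd d => (Nat.le_succ _).trans d.dim_le
  | .pse _ _ => le_rfl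

/-- A derivation of `Γ ⊢ps x : A` ends with a chain of steps `psd`, which starts from the type of
the last variable of `Γ` and in which every step lowers the dimension by one. Hence `Γ` and the
dimension of `A` determine the whole derivation. -/
theorem PsAux.sigma_unique : {Γ : PreCtx Empty} → {x x' : ℕ} → {A A' : PreTy Empty} →
    (d : PsAux Γ x A) → (d' : PsAux Γ x' A') → A.dim = A'.dim →
    (⟨(x, A), d⟩ : Σ p : ℕ × PreTy Empty, PsAux Γ p.1 p.2) = ⟨(x', A'), d'⟩
  | _, _, _, _, _, .psd d, .psd d', h => by
    have := PsAux.sigma_unique d d' (congrArg (· + 1) h)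
    cases this
    rfl
  | _, _, _, _, _, .psd d, .pss, h => by
    have := d.dim_le
    simp [PreTy.dim] at this
  | _, _, _, _, _, .psd d, .pse _ _, h => by
    have := d.dim_le
    simp only [PreTy.dim] at this h
    omega
  | _, _, _, _, _, .pss, .pss, h => rfl
  | _, _, _, _, _, .pss, .psd d, h => by
    have := d.dim_le
    simp [PreTy.dim] at this
  | _, _, _, _, _, .pse _ _, .psd d, h => by
    have := d.dim_le
    simp only [PreTy.dim] at this h
    omega
  | _, _, _, _, _, .pse d _, .pse d' _, h => by
    have := PsAux.sigma_unique d d' rfl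
    cases this
    rfl

instance (Γ : PreCtx Empty) (x : ℕ) (A : PreTy Empty) : Subsingleton (PsAux Γ x A) :=
  ⟨fun d d' => by
    have := PsAux.sigma_unique d d' rfl
    cases this
    rfl⟩

instance (Γ : PreCtx Empty) : Subsingleton (Ps Γ) :=
  ⟨fun e e' => by
    obtain ⟨d⟩ := e
    obtain ⟨d'⟩ := e'
    have := PsAux.sigma_unique d d' rfl
    cases this
    rfl⟩

end Uniqueness

/-! ### The category with families of a type theory -/

section Families

variable {I : Type} {S : Signature I}

theorem Signature.Sub.ext {Δ Γ : PreCtx I} {γ δ : S.Sub Δ Γ} (h : γ.1 = δ.1) : γ = δ :=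
  Sigma.ext h (Subsingleton.helim (by rw [h]) _ _)

theorem Signature.Ty.ext {Γ : PreCtx I} {A B : S.Ty Γ} (h : A.1 = B.1) : A = B :=
  Sigma.ext h (Subsingleton.helim (by rw [h]) _ _)

theorem Signature.Tm.heq {Γ : PreCtx I} {A B : PreTy I} (h : A = B) {t : S.Tm Γ A} {u : S.Tm Γ B}
    (e : t.1 = u.1) : HEq t u := by
  subst h
  exact heq_of_eq (Sigma.ext e (Subsingleton.helim (by rw [e]) _ _))

variable (S) in
/-- The syntactic category with families. Since derivations are unique, its equations need only be
checked on the raw syntax. -/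
def Signature.cwf : CwF S.Ctx (fun Δ Γ => S.Sub Δ.1 Γ.1) (fun Γ => S.Ty Γ.1)
    (fun Γ A => S.Tm Γ.1 A.1) where
  ident Γ := ⟨PreSub.ident Γ.1, Γ.2.ident⟩
  comp γ δ := ⟨γ.1.comp δ.1, γ.2.comp δ.2⟩
  ident_comp γ := Signature.Sub.ext γ.2.ident_comp
  comp_ident γ := Signature.Sub.ext (PreSub.comp_ident _ γ.1)
  assoc γ δ θ := Signature.Sub.ext
    (PreSub.comp_assoc δ.1 θ.1 γ.1 (δ.2.dom_eq ▸ γ.2.vars_subset))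
  empty := ⟨.nil, .ec⟩
  toEmpty Γ := ⟨.nil, .es Γ.2⟩
  toEmpty_unique := fun ⟨_, .es _⟩ => Signature.Sub.ext rfl
  substTy A γ := ⟨A.1.subst γ.1, A.2.subst γ.2⟩
  substTy_ident A := Signature.Ty.ext (PreTy.subst_ident _ A.1)
  substTy_comp A γ δ := Signature.Ty.ext
    (PreTy.subst_comp γ.1 δ.1 A.1 (γ.2.dom_eq ▸ A.2.vars_subset))
  substTm t γ := ⟨t.1.subst γ.1, t.2.subst γ.2⟩
  substTm_ident t := Signature.Tm.heq (PreTy.subst_ident _ _) (PreTm.subst_ident _ t.1)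
  substTm_comp {_ _ _ A} t γ δ := Signature.Tm.heq
    (PreTy.subst_comp γ.1 δ.1 A.1 (γ.2.dom_eq ▸ A.2.vars_subset))
    (PreTm.subst_comp γ.1 δ.1 t.1 (γ.2.dom_eq ▸ t.2.vars_subset.1))
  ext Γ A := ⟨Γ.1.snoc Γ.1.length A.1, .cc Γ.2 A.2 rfl⟩
  proj {Γ} A := ⟨PreSub.ident Γ.1, Γ.2.ident.weaken (.cc Γ.2 A.2 rfl)⟩
  last {Γ} A := ⟨.var Γ.1.length,
    show TmD S (Γ.1.snoc Γ.1.length A.1) (.var Γ.1.length) (A.1.subst (PreSub.ident Γ.1)) by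
      rw [PreTy.subst_ident]; exact .var (.cc Γ.2 A.2 rfl) .here⟩
  pair {Γ _ A} γ t := ⟨γ.1.snoc Γ.1.length t.1, .sc γ.2 (.cc Γ.2 A.2 rfl) t.2 rfl⟩
  proj_pair {Γ _ A} γ t := by
    refine Signature.Sub.ext ((PreSub.comp_snoc γ.1 t.1 _ ?_).trans γ.2.ident_comp)
    rw [PreSub.vars_ident]
    exact (CtxD.cc Γ.2 A.2 rfl).notMem_vars
  last_pair {Γ _ A} γ t := by
    refine Signature.Tm.heq ?_ (by simp [PreTm.subst, PreSub.lookup])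
    have h : Γ.1.length ∉ A.1.vars := fun h =>
      (CtxD.cc Γ.2 A.2 rfl).notMem_vars (A.2.vars_subset h)
    simp only [PreTy.subst_ident, PreTy.subst_snoc γ.1 t.1 A.1 h]
  pair_unique {Γ Δ A} γ t σ hγ ht := by
    obtain ⟨σ, d⟩ := σ
    obtain _ | ⟨g, c, d, h⟩ := d
    rename_i σ _ s
    subst h
    have hσ : γ = ⟨σ, g⟩ := by
      refine hγ.symm.trans (Signature.Sub.ext ((PreSub.comp_snoc σ s _ ?_).trans g.ident_comp))
      rw [PreSub.vars_ident]
      exact c.notMem_vars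
    subst hσ
    have h : Γ.1.length ∉ A.1.vars := fun h => c.notMem_vars (A.2.vars_subset h)
    have hs : HEq (⟨s, d⟩ : S.Tm Δ.1 (A.1.subst σ)) t := by
      refine HEq.trans (Signature.Tm.heq ?_ ?_) ht
      · simp only [PreTy.subst_ident, PreTy.subst_snoc σ s A.1 h]
      · simp [PreTm.subst, PreSub.lookup]
    exact Signature.Sub.ext (by rw [← eq_of_heq hs])

end Families

/-! ### Spheres and disks -/

section Spheres

variable {I : Type} {S : Signature I}

theorem length_sphere : ∀ n : ℕ, (sphere I n).length = 2 * n
  | 0 => rfl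
  | n + 1 => by simp only [sphere, PreCtx.length, length_sphere n]; ring

theorem sphere_succ (n : ℕ) : sphere I (n + 1) =
    ((sphere I n).snoc (2 * n) (univTy I n)).snoc (2 * n + 1) (univTy I n) := by
  simp only [sphere, PreCtx.length, length_sphere]

theorem dim_univTy : ∀ n : ℕ, (univTy I n).dim = n
  | 0 => rfl
  | n + 1 => by simp only [univTy, PreTy.dim, dim_univTy n]

mutual
/-- The universal types, the disks and the spheres are derivable. -/
def univTyD : ∀ n : ℕ, TyD S (sphere I n) (univTy I n)
  | 0 => .ob .ec
  | n + 1 => .ar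
    (by rw [sphere_succ]; exact .var (sphere_succ (I := I) n ▸ sphereD (n + 1)) (.there .here))
    (by rw [sphere_succ]; exact .var (sphere_succ (I := I) n ▸ sphereD (n + 1)) .here)

def diskD : ∀ n : ℕ, CtxD S (disk I n)
  | n => .cc (sphereD n) (univTyD n) rfl

def sphereD : ∀ n : ℕ, CtxD S (sphere I n)
  | 0 => .ec
  | n + 1 => .cc (diskD n) ((univTyD n).weaken (diskD n)) rfl
end

/-- A substitution to a sphere of positive dimension consists of a substitution to the preceding
sphere and of two parallel terms. -/
theorem SubD.sphere_succ_cases {Γ : PreCtx I} {n : ℕ} {γ : PreSub I}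
    (d : SubD S Γ γ (sphere I (n + 1))) : ∃ (δ : PreSub I) (t u : PreTm I),
      γ = (δ.snoc (2 * n) t).snoc (2 * n + 1) u ∧ Nonempty (SubD S Γ δ (sphere I n)) ∧
      (univTy I (n + 1)).subst γ = .arr ((univTy I n).subst δ) t u := by
  rw [sphere_succ] at d
  obtain _ | ⟨_ | ⟨g, c, t, h⟩, c', u, h'⟩ := d
  subst h h'
  refine ⟨_, _, _, rfl, ⟨g⟩, ?_⟩
  have hn : 2 * n ∉ (univTy I n).vars := fun h => c.notMem_vars (c.vars_last_subset h)
  have hn' : 2 * n + 1 ∉ (univTy I n).vars := fun h => c'.notMem_vars (c'.vars_last_subset h)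
  simp [univTy, PreTy.subst, PreTm.subst, PreSub.lookup, PreTy.subst_snoc _ _ _ hn,
    PreTy.subst_snoc _ _ _ hn']

theorem SubD.univTy_subst_injective {Γ : PreCtx I} : ∀ {n : ℕ} {γ δ : PreSub I},
    SubD S Γ γ (sphere I n) → SubD S Γ δ (sphere I n) →
    (univTy I n).subst γ = (univTy I n).subst δ → γ = δ
  | 0, _, _, .es _, .es _, _ => rfl
  | n + 1, _, _, d, e, h => by
    obtain ⟨γ, t, u, rfl, ⟨d⟩, hd⟩ := d.sphere_succ_cases
    obtain ⟨δ, t', u', rfl, ⟨e⟩, he⟩ := e.sphere_succ_cases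
    rw [hd, he, PreTy.arr.injEq] at h
    rw [d.univTy_subst_injective e h.1, h.2.1, h.2.2]

theorem TyD.exists_univTy_subst {Γ : PreCtx I} : ∀ {A : PreTy I}, TyD S Γ A →
    ∃ (n : ℕ) (γ : S.Sub Γ (sphere I n)), (univTy I n).subst γ.1 = A
  | .obj, .ob c => ⟨0, ⟨.nil, .es c⟩, rfl⟩
  | .arr A t u, .ar d e => by
    obtain ⟨n, ⟨γ, g⟩, rfl⟩ := d.ty.exists_univTy_subst
    -- `t` and `u` extend the substitution to the boundary sphere of `A`; the second one still has the
    -- type `A`, as the variable `2 * n` does not occur in the universal type.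
    have h := sphere_succ (I := I) n
    have c : CtxD S (sphere I (n + 1)) := sphereD (n + 1)
    rw [h] at c
    have hn : 2 * n ∉ (univTy I n).vars := fun h =>
      c.tail.notMem_vars (c.tail.vars_last_subset h)
    have g' := SubD.sc (SubD.sc g c.tail d rfl) c (by rwa [PreTy.subst_snoc _ _ _ hn]) rfl
    rw [← h] at g'
    refine ⟨n + 1, ⟨_, g'⟩, ?_⟩
    obtain ⟨δ, t', u', hδ, -, hs⟩ := g'.sphere_succ_cases
    simp only [PreSub.snoc.injEq, true_and] at hδ
    obtain ⟨⟨rfl, rfl⟩, rfl⟩ := hδ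
    exact hs

variable (S) in
/-- The sphere contexts classify the types of `Γ`. The dimension of a type is the dimension of the
sphere, and the iterated boundary terms are the entries of the substitution. -/
noncomputable def sphereEquiv (Γ : PreCtx I) : (Σ n : ℕ, S.Sub Γ (sphere I n)) ≃ S.Ty Γ :=
  Equiv.ofBijective (fun p => ⟨(univTy I p.1).subst p.2.1, (univTyD p.1).subst p.2.2⟩) <| by
    constructor
    · rintro ⟨n, γ⟩ ⟨m, δ⟩ h
      have h : (univTy I n).subst γ.1 = (univTy I m).subst δ.1 := congrArg Sigma.fst h
      obtain rfl : n = m := by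
        simpa only [PreTy.dim_subst, dim_univTy] using congrArg PreTy.dim h
      exact congrArg _ (Signature.Sub.ext (γ.2.univTy_subst_injective δ.2 h))
    · rintro ⟨A, d⟩
      obtain ⟨n, γ, h⟩ := d.exists_univTy_subst
      exact ⟨⟨n, γ⟩, Signature.Ty.ext h⟩

end Spheres

/-! ### Injectivity of the numbering -/

section Injectivity

variable {I : Type} {c : I → ℕ}

mutual
theorem PreTy.code_injective (hc : Function.Injective c) :
    ∀ {A B : PreTy I}, A.code c = B.code c → A = B
  | .obj, .obj, _ => rfl
  | .obj, .arr _ _ _, h => by simp [PreTy.code] at h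
  | .arr _ _ _, .obj, h => by simp [PreTy.code] at h
  | .arr A t u, .arr B s v, h => by
    simp only [PreTy.code, Nat.add_right_cancel_iff, Nat.pair_eq_pair] at h
    rw [PreTy.code_injective hc h.1, PreTm.code_injective hc h.2.1,
      PreTm.code_injective hc h.2.2]

theorem PreTm.code_injective (hc : Function.Injective c) :
    ∀ {t u : PreTm I}, t.code c = u.code c → t = u
  | .var x, .var y, h => by
    simp only [PreTm.code] at h
    rw [show x = y by omega]
  | .var _, .con _ _, h => by simp only [PreTm.code] at h; omega
  | .con _ _, .var _, h => by simp only [PreTm.code] at h; omega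
  | .con i γ, .con j δ, h => by
    simp only [PreTm.code] at h
    have h : Nat.pair (c i) (γ.code c) = Nat.pair (c j) (δ.code c) := by omega
    rw [Nat.pair_eq_pair] at h
    rw [hc h.1, PreSub.code_injective hc h.2]

theorem PreSub.code_injective (hc : Function.Injective c) :
    ∀ {γ δ : PreSub I}, γ.code c = δ.code c → γ = δ
  | .nil, .nil, _ => rfl
  | .nil, .snoc _ _ _, h => by simp [PreSub.code] at h
  | .snoc _ _ _, .nil, h => by simp [PreSub.code] at h
  | .snoc γ x t, .snoc δ y u, h => by
    simp only [PreSub.code, Nat.add_right_cancel_iff, Nat.pair_eq_pair] at h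
    rw [PreSub.code_injective hc h.1, h.2.1, PreTm.code_injective hc h.2.2]
end

theorem PreCtx.code_injective (hc : Function.Injective c) :
    ∀ {Γ Δ : PreCtx I}, Γ.code c = Δ.code c → Γ = Δ
  | .nil, .nil, _ => rfl
  | .nil, .snoc _ _ _, h => by simp [PreCtx.code] at h
  | .snoc _ _ _, .nil, h => by simp [PreCtx.code] at h
  | .snoc Γ x A, .snoc Δ y B, h => by
    simp only [PreCtx.code, Nat.add_right_cancel_iff, Nat.pair_eq_pair] at h
    rw [PreCtx.code_injective hc h.1, h.2.1, PreTy.code_injective hc h.2.2]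

/-- The number of a ps-context does not record its derivation, which is unique. -/
theorem PsCtx.code_injective : Function.Injective PsCtx.code := by
  rintro ⟨Γ, d⟩ ⟨Δ, e⟩ h
  obtain rfl : Γ = Δ := PreCtx.code_injective (Function.injective_of_subsingleton _) h
  rw [Subsingleton.elim d e]

mutual
theorem CohTy.code_injective : ∀ {A B : CohTy}, A.code = B.code → A = B
  | .obj, .obj, _ => rfl
  | .obj, .arr _ _ _, h => by simp [CohTy.code] at h
  | .arr _ _ _, .obj, h => by simp [CohTy.code] at h
  | .arr A t u, .arr B s v, h => by
    simp only [CohTy.code, Nat.add_right_cancel_iff, Nat.pair_eq_pair] at h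
    rw [CohTy.code_injective h.1, CohTm.code_injective h.2.1, CohTm.code_injective h.2.2]

theorem CohTm.code_injective : ∀ {t u : CohTm}, t.code = u.code → t = u
  | .var x, .var y, h => by
    simp only [CohTm.code] at h
    rw [show x = y by omega]
  | .var _, .con _ _ _, h => by simp only [CohTm.code] at h; omega
  | .con _ _ _, .var _, h => by simp only [CohTm.code] at h; omega
  | .con Γ A γ, .con Δ B δ, h => by
    simp only [CohTm.code] at h
    have h : Nat.pair (Nat.pair Γ.code A.code) γ.code =
      Nat.pair (Nat.pair Δ.code B.code) δ.code := by omega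
    simp only [Nat.pair_eq_pair] at h
    rw [PsCtx.code_injective h.1.1, CohTy.code_injective h.1.2, CohSub.code_injective h.2]

theorem CohSub.code_injective : ∀ {γ δ : CohSub}, γ.code = δ.code → γ = δ
  | .nil, .nil, _ => rfl
  | .nil, .snoc _ _ _, h => by simp [CohSub.code] at h
  | .snoc _ _ _, .nil, h => by simp [CohSub.code] at h
  | .snoc γ x t, .snoc δ y u, h => by
    simp only [CohSub.code, Nat.add_right_cancel_iff, Nat.pair_eq_pair] at h
    rw [CohSub.code_injective h.1, h.2.1, CohTm.code_injective h.2.2]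
end

theorem J.code_injective : Function.Injective J.code := by
  rintro ⟨Γ, A, h⟩ ⟨Δ, B, h'⟩ e
  simp only [J.code, Nat.pair_eq_pair] at e
  obtain rfl := PsCtx.code_injective e.1
  obtain rfl := CohTy.code_injective e.2
  rfl

mutual
theorem CohTy.code_toPre : ∀ (A : CohTy) (h : A.Good), (A.toPre h).code J.code = A.code
  | .obj, _ => rfl
  | .arr A t u, h => by
    simp only [CohTy.toPre, PreTy.code, CohTy.code]
    rw [A.code_toPre h.1, t.code_toPre h.2.1, u.code_toPre h.2.2]

theorem CohTm.code_toPre : ∀ (t : CohTm) (h : t.Good), (t.toPre h).code J.code = t.code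
  | .var _, _ => rfl
  | .con Γ A γ, h => by
    simp only [CohTm.toPre, PreTm.code, CohTm.code]
    rw [γ.code_toPre h.2]
    rfl

theorem CohSub.code_toPre : ∀ (γ : CohSub) (h : γ.Good), (γ.toPre h).code J.code = γ.code
  | .nil, _ => rfl
  | .snoc γ x t, h => by
    simp only [CohSub.toPre, PreSub.code, CohSub.code]
    rw [γ.code_toPre h.1, t.code_toPre h.2]
end

theorem J.code_eq (j : J) : j.code = Nat.pair j.ctx.code (j.ti.code J.code) := by
  rw [J.code, J.ti, CohTy.code_toPre]

mutual
theorem PreTy.code_lift (c' : Empty → ℕ) :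
    ∀ A : PreTy Empty, (A.lift I).code c = A.code c'
  | .obj => rfl
  | .arr A t u => by
    simp only [PreTy.lift, PreTy.code, PreTy.code_lift c' A, PreTm.code_lift c' t,
      PreTm.code_lift c' u]

theorem PreTm.code_lift (c' : Empty → ℕ) :
    ∀ t : PreTm Empty, (t.lift I).code c = t.code c'
  | .var _ => rfl
  | .con i _ => i.elim
end

theorem PreCtx.code_lift (c' : Empty → ℕ) :
    ∀ Γ : PreCtx Empty, (Γ.lift I).code c = Γ.code c'
  | .nil => rfl
  | .snoc Γ x A => by
    simp only [PreCtx.lift, PreCtx.code, PreCtx.code_lift c' Γ, PreTy.code_lift c' A]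

end Injectivity

/-! ### Recursion on the numbers of expressions -/

section PrimrecRules

attribute [fun_prop] Primrec Primrec.id Primrec.const Primrec.comp

variable {α β γ σ : Type*} [Primcodable α] [Primcodable β] [Primcodable γ] [Primcodable σ]

-- The closure properties of the primitive recursive functions, in the form that `fun_prop` uses.

@[fun_prop]
theorem Primrec.fst_comp {f : α → β × γ} (hf : Primrec f) : Primrec fun a => (f a).1 :=
  Primrec.fst.comp hf

@[fun_prop]
theorem Primrec.snd_comp {f : α → β × γ} (hf : Primrec f) : Primrec fun a => (f a).2 :=
  Primrec.snd.comp hf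

@[fun_prop]
theorem Primrec.prodMk {f : α → β} {g : α → γ} (hf : Primrec f) (hg : Primrec g) :
    Primrec fun a => (f a, g a) :=
  Primrec.pair hf hg

@[fun_prop]
theorem Primrec.natPair_comp {f g : α → ℕ} (hf : Primrec f) (hg : Primrec g) :
    Primrec fun a => Nat.pair (f a) (g a) :=
  Primrec₂.natPair.comp hf hg

@[fun_prop]
theorem Primrec.natUnpair_comp {f : α → ℕ} (hf : Primrec f) : Primrec fun a => Nat.unpair (f a) :=
  Primrec.unpair.comp hf

@[fun_prop]
theorem Primrec.add_comp {f g : α → ℕ} (hf : Primrec f) (hg : Primrec g) :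
    Primrec fun a => f a + g a :=
  Primrec.nat_add.comp hf hg

@[fun_prop]
theorem Primrec.sub_comp {f g : α → ℕ} (hf : Primrec f) (hg : Primrec g) :
    Primrec fun a => f a - g a :=
  Primrec.nat_sub.comp hf hg

@[fun_prop]
theorem Primrec.mul_comp {f g : α → ℕ} (hf : Primrec f) (hg : Primrec g) :
    Primrec fun a => f a * g a :=
  Primrec.nat_mul.comp hf hg

@[fun_prop]
theorem Primrec.div_comp {f g : α → ℕ} (hf : Primrec f) (hg : Primrec g) :
    Primrec fun a => f a / g a :=
  Primrec.nat_div.comp hf hg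

@[fun_prop]
theorem Primrec.mod_comp {f g : α → ℕ} (hf : Primrec f) (hg : Primrec g) :
    Primrec fun a => f a % g a :=
  Primrec.nat_mod.comp hf hg

@[fun_prop]
theorem Primrec.max_comp {f g : α → ℕ} (hf : Primrec f) (hg : Primrec g) :
    Primrec fun a => max (f a) (g a) :=
  Primrec.nat_max.comp hf hg

@[fun_prop]
theorem Primrec.ble_comp {f g : α → ℕ} (hf : Primrec f) (hg : Primrec g) :
    Primrec fun a => Nat.ble (f a) (g a) :=
  (Primrec.nat_le.decide.comp hf hg).of_eq fun _ => by
    rw [Bool.eq_iff_iff, decide_eq_true_iff, Nat.ble_eq]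

@[fun_prop]
theorem Primrec.beq_comp [DecidableEq β] {f g : α → β} (hf : Primrec f) (hg : Primrec g) :
    Primrec fun a => f a == g a :=
  Primrec.beq.comp hf hg

@[fun_prop]
theorem Primrec.and_comp {f g : α → Bool} (hf : Primrec f) (hg : Primrec g) :
    Primrec fun a => f a && g a :=
  Primrec.and.comp hf hg

@[fun_prop]
theorem Primrec.or_comp {f g : α → Bool} (hf : Primrec f) (hg : Primrec g) :
    Primrec fun a => f a || g a :=
  Primrec.or.comp hf hg

@[fun_prop]
theorem Primrec.not_comp {f : α → Bool} (hf : Primrec f) : Primrec fun a => !f a :=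
  Primrec.not.comp hf

@[fun_prop]
theorem Primrec.cond_comp {c : α → Bool} {f g : α → σ} (hc : Primrec c) (hf : Primrec f)
    (hg : Primrec g) : Primrec fun a => bif c a then f a else g a :=
  Primrec.cond hc hf hg

@[fun_prop]
theorem Primrec.listCons_comp {f : α → β} {g : α → List β} (hf : Primrec f) (hg : Primrec g) :
    Primrec fun a => f a :: g a :=
  Primrec.list_cons.comp hf hg

@[fun_prop]
theorem Primrec.listAppend_comp {f g : α → List β} (hf : Primrec f) (hg : Primrec g) :
    Primrec fun a => f a ++ g a :=
  Primrec.list_append.comp hf hg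

@[fun_prop]
theorem Primrec.listTail_comp {f : α → List β} (hf : Primrec f) : Primrec fun a => (f a).tail :=
  Primrec.list_tail.comp hf

@[fun_prop]
theorem Primrec.listLength_comp {f : α → List β} (hf : Primrec f) :
    Primrec fun a => (f a).length :=
  Primrec.list_length.comp hf

/-- Course-of-values recursion. The step function `g` receives the argument `n` and a function that
agrees with `f a` below `n`; it is only tested on functions that are given by lists. -/
theorem Primrec.of_strongRec [Inhabited σ] {f : α → ℕ → σ} {g : α → ℕ → (ℕ → σ) → σ}
    (hg : Primrec fun p : α × List σ => g p.1 p.2.length fun k => p.2.getD k default)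
    (H : ∀ a n (r : ℕ → σ), (∀ k < n, r k = f a k) → g a n r = f a n) :
    Primrec fun p : α × ℕ => f p.1 p.2 := by
  refine Primrec.nat_strong_rec f (g := fun a L => some (g a L.length fun k => L.getD k default))
    (Primrec.option_some.comp hg) fun a n => ?_
  rw [List.length_map, List.length_range, H]
  intro k hk
  simp [List.getD, hk]

@[fun_prop]
theorem Primrec.listGetD_comp {d : β} {f : α → List β} {g : α → ℕ} (hf : Primrec f)
    (hg : Primrec g) : Primrec fun a => (f a).getD (g a) d :=
  (Primrec.list_getD d).comp hf hg

/-- A predicate that holds at `a` if and only if a primitive recursive test succeeds and the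
predicate holds at finitely many smaller arguments, computed from `a`, is primitive recursive. -/
theorem PrimrecPred.of_forall_mem {α : Type} [Primcodable α] {P : α → Prop} {s : α → Bool}
    {l : α → List α} {m : α → ℕ} (hs : Primrec s) (hl : Primrec l) (hm : Primrec m)
    (hlt : ∀ a, ∀ b ∈ l a, m b < m a) (hP : ∀ a, P a ↔ s a = true ∧ ∀ b ∈ l a, P b) :
    PrimrecPred P := by
  classical
  refine ⟨Classical.decPred P, ?_⟩
  have hall : Primrec fun L : List Bool => L.all id :=
    ((PrimrecPred.forall_mem_list (p := fun b : Bool => b = true)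
      (Primrec.eq.comp .id (.const true))).decide).of_eq fun L => by
        rw [Bool.eq_iff_iff]
        simp
  -- Recursion along the tree of recursive calls, whose values are combined by conjunction.
  refine Primrec.nat_omega_rec' _ hm hl (g := fun a L => some (s a && L.all id))
    (Primrec.option_some.comp (Primrec.and.comp (hs.comp .fst) (hall.comp .snd))) hlt fun a => ?_
  rw [Option.some_inj, Bool.eq_iff_iff]
  simp [hP a]

end PrimrecRules

namespace Code

/-- The common form of the numbers of arrow types, extended substitutions and extended contexts. -/
def node (a b c : ℕ) : ℕ := Nat.pair a (Nat.pair b c) + 1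

/-- The components of a node, and junk at `0`, where `node₁` is `0`. -/
def node₁ (n : ℕ) : ℕ := (Nat.unpair (n - 1)).1
def node₂ (n : ℕ) : ℕ := (Nat.unpair (Nat.unpair (n - 1)).2).1
def node₃ (n : ℕ) : ℕ := (Nat.unpair (Nat.unpair (n - 1)).2).2

/-- The number of the term with constructor `(g, a)` and substitution `s`. -/
def cell (g a s : ℕ) : ℕ := 2 * Nat.pair (Nat.pair g a) s + 1

/-- The ps-context of the constructor of a constructor term; junk on even numbers, which are the
numbers of variables. -/
def cellCtx (n : ℕ) : ℕ := (Nat.unpair (Nat.unpair (n / 2)).1).1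
/-- The type of the constructor of a constructor term. -/
def cellTy (n : ℕ) : ℕ := (Nat.unpair (Nat.unpair (n / 2)).1).2
/-- The substitution of a constructor term. -/
def cellSub (n : ℕ) : ℕ := (Nat.unpair (n / 2)).2

section
variable (a b c : ℕ)

@[simp] theorem node_ne_zero : node a b c ≠ 0 := Nat.succ_ne_zero _
@[simp] theorem node₁_node : node₁ (node a b c) = a := by simp [node, node₁]
@[simp] theorem node₂_node : node₂ (node a b c) = b := by simp [node, node₂]
@[simp] theorem node₃_node : node₃ (node a b c) = c := by simp [node, node₃]
@[simp] theorem cell_mod_two : cell a b c % 2 = 1 := by rw [cell]; omega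

theorem cell_div_two : cell a b c / 2 = Nat.pair (Nat.pair a b) c := by rw [cell]; omega

@[simp] theorem cellCtx_cell : cellCtx (cell a b c) = a := by
  rw [cellCtx, cell_div_two]; simp

@[simp] theorem cellTy_cell : cellTy (cell a b c) = b := by
  rw [cellTy, cell_div_two]; simp

@[simp] theorem cellSub_cell : cellSub (cell a b c) = c := by
  rw [cellSub, cell_div_two]; simp

theorem add_lt_node : a + b + c < node a b c := by
  have := Nat.add_le_pair a (Nat.pair b c)
  have := Nat.add_le_pair b c
  rw [node]
  omega

theorem add_lt_cell : a + b + c < cell a b c := by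
  have := Nat.add_le_pair (Nat.pair a b) c
  have := Nat.add_le_pair a b
  rw [cell]
  omega
end

theorem node_eta {n : ℕ} (h : n ≠ 0) : node (node₁ n) (node₂ n) (node₃ n) = n := by
  simp only [node, node₁, node₂, node₃, Nat.pair_unpair]
  omega

theorem cell_eta {n : ℕ} (h : n % 2 = 1) : cell (cellCtx n) (cellTy n) (cellSub n) = n := by
  simp only [cell, cellCtx, cellTy, cellSub, Nat.pair_unpair]
  omega

theorem node_lt {n : ℕ} (h : n ≠ 0) : node₁ n + node₂ n + node₃ n < n :=
  (add_lt_node _ _ _).trans_eq (node_eta h)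

theorem node₁_node₁_lt {n : ℕ} (h : n ≠ 0) : node₁ (node₁ n) < n := by
  have := node_lt h
  by_cases h' : node₁ n = 0
  · rw [h']
    exact Nat.pos_of_ne_zero h
  · have := node_lt h'
    omega

theorem cell_lt {n : ℕ} (h : n % 2 = 1) : cellCtx n + cellTy n + cellSub n < n :=
  (add_lt_cell _ _ _).trans_eq (cell_eta h)

section
variable {α : Type*} [Primcodable α] {f g h : α → ℕ}

@[fun_prop] theorem primrec_node (hf : Primrec f) (hg : Primrec g) (hh : Primrec h) :
    Primrec fun a => node (f a) (g a) (h a) := by unfold node; fun_prop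

@[fun_prop] theorem primrec_node₁ (hf : Primrec f) : Primrec fun a => node₁ (f a) := by
  unfold node₁; fun_prop

@[fun_prop] theorem primrec_node₂ (hf : Primrec f) : Primrec fun a => node₂ (f a) := by
  unfold node₂; fun_prop

@[fun_prop] theorem primrec_node₃ (hf : Primrec f) : Primrec fun a => node₃ (f a) := by
  unfold node₃; fun_prop

@[fun_prop] theorem primrec_cell (hf : Primrec f) (hg : Primrec g) (hh : Primrec h) :
    Primrec fun a => cell (f a) (g a) (h a) := by unfold cell; fun_prop

@[fun_prop] theorem primrec_cellCtx (hf : Primrec f) : Primrec fun a => cellCtx (f a) := by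
  unfold cellCtx; fun_prop

@[fun_prop] theorem primrec_cellTy (hf : Primrec f) : Primrec fun a => cellTy (f a) := by
  unfold cellTy; fun_prop

@[fun_prop] theorem primrec_cellSub (hf : Primrec f) : Primrec fun a => cellSub (f a) := by
  unfold cellSub; fun_prop
end

section Recursors

variable {α σ : Type}

/-- Recursion along the first component of nodes. The step function for `n` receives `n`, the value
at `node₁ n`, and the value at `node₁ (node₁ n)`. -/
def nodeRec (z : α → σ) (s : α → ℕ × σ × σ → σ) (a : α) (n : ℕ) : σ :=
  if _h : n = 0 then z a
  else s a (n, nodeRec z s a (node₁ n), nodeRec z s a (node₁ (node₁ n)))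
termination_by n
decreasing_by
  · have := node_lt ‹_›
    omega
  · exact node₁_node₁_lt ‹_›

theorem nodeRec_zero (z : α → σ) (s : α → ℕ × σ × σ → σ) (a : α) : nodeRec z s a 0 = z a := by
  rw [nodeRec, dif_pos rfl]

theorem nodeRec_node (z : α → σ) (s : α → ℕ × σ × σ → σ) (a : α) (x y w : ℕ) :
    nodeRec z s a (node x y w) =
      s a (node x y w, nodeRec z s a x, nodeRec z s a (node₁ x)) := by
  rw [nodeRec, dif_neg (node_ne_zero x y w), node₁_node]

theorem primrec_nodeRec [Primcodable α] [Primcodable σ] [Inhabited σ] {z : α → σ}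
    {s : α → ℕ × σ × σ → σ}
    (hz : Primrec z) (hs : Primrec fun p : α × ℕ × σ × σ => s p.1 p.2) :
    Primrec fun p : α × ℕ => nodeRec z s p.1 p.2 := by
  refine Primrec.of_strongRec
    (g := fun a n r => bif n == 0 then z a else s a (n, r (node₁ n), r (node₁ (node₁ n))))
    (by fun_prop) ?_
  intro a n r hr
  rw [nodeRec]
  by_cases h : n = 0
  · simp [h]
  · have := node_lt h
    rw [hr _ (by omega), hr _ (node₁_node₁_lt h)]
    simp [h, beq_false_of_ne h]

/-- Recursion on types, terms and substitutions: the value at `n` consists of the values of `n` as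
the number of a type, of a term and of a substitution. The arguments are the clauses for the object
type, arrows, variables, constructor terms, the empty substitution and extended substitutions. The
clause for constructor terms receives the number of the term and the values at the type of the
constructor and at the substitution. -/
def synRec (o : α → σ) (ar : α → σ × σ × σ → σ) (v : α → ℕ → σ) (co : α → ℕ × σ × σ → σ)
    (ni : α → σ) (sn : α → ℕ × σ × σ → σ) (a : α) (n : ℕ) : σ × σ × σ :=
  if _h : n = 0 then (o a, v a 0, ni a)
  else
    let r₁ := synRec o ar v co ni sn a (node₁ n)
    let r₂ := synRec o ar v co ni sn a (node₂ n)
    let r₃ := synRec o ar v co ni sn a (node₃ n)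
    (ar a (r₁.1, r₂.2.1, r₃.2.1),
      if _h : n % 2 = 1 then co a (n, (synRec o ar v co ni sn a (cellTy n)).1,
        (synRec o ar v co ni sn a (cellSub n)).2.2)
      else v a (n / 2),
      sn a (n, r₁.2.2, r₃.2.1))
termination_by n
decreasing_by
  · have := node_lt ‹_›
    omega
  · have := node_lt ‹_›
    omega
  · have := node_lt ‹_›
    omega
  · have := cell_lt ‹_›
    omega
  · have := cell_lt ‹_›
    omega

section SynRec

variable (o : α → σ) (ar : α → σ × σ × σ → σ) (v : α → ℕ → σ) (co : α → ℕ × σ × σ → σ)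
  (ni : α → σ) (sn : α → ℕ × σ × σ → σ) (a : α)

theorem synRec_zero : synRec o ar v co ni sn a 0 = (o a, v a 0, ni a) := by
  rw [synRec, dif_pos rfl]

theorem synRec_node_ty (x y w : ℕ) : (synRec o ar v co ni sn a (node x y w)).1 =
    ar a ((synRec o ar v co ni sn a x).1, (synRec o ar v co ni sn a y).2.1,
      (synRec o ar v co ni sn a w).2.1) := by
  rw [synRec, dif_neg (node_ne_zero x y w), node₁_node, node₂_node, node₃_node]

theorem synRec_node_sub (x y w : ℕ) : (synRec o ar v co ni sn a (node x y w)).2.2 =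
    sn a (node x y w, (synRec o ar v co ni sn a x).2.2, (synRec o ar v co ni sn a w).2.1) := by
  rw [synRec, dif_neg (node_ne_zero x y w), node₁_node, node₃_node]

theorem synRec_var (x : ℕ) : (synRec o ar v co ni sn a (2 * x)).2.1 = v a x := by
  rw [synRec]
  split
  · rw [show x = 0 by omega]
  · simp

theorem synRec_cell (x y w : ℕ) : (synRec o ar v co ni sn a (cell x y w)).2.1 =
    co a (cell x y w, (synRec o ar v co ni sn a y).1, (synRec o ar v co ni sn a w).2.2) := by
  rw [synRec, dif_neg (Nat.ne_of_gt (Nat.zero_lt_of_lt (add_lt_cell x y w)))]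
  simp

end SynRec

theorem primrec_synRec [Primcodable α] [Primcodable σ] [Inhabited σ] {o : α → σ}
    {ar : α → σ × σ × σ → σ} {v : α → ℕ → σ} {co : α → ℕ × σ × σ → σ} {ni : α → σ}
    {sn : α → ℕ × σ × σ → σ} (ho : Primrec o)
    (har : Primrec fun p : α × σ × σ × σ => ar p.1 p.2) (hv : Primrec fun p : α × ℕ => v p.1 p.2)
    (hco : Primrec fun p : α × ℕ × σ × σ => co p.1 p.2) (hni : Primrec ni)
    (hsn : Primrec fun p : α × ℕ × σ × σ => sn p.1 p.2) :
    Primrec fun p : α × ℕ => synRec o ar v co ni sn p.1 p.2 := by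
  refine Primrec.of_strongRec (g := fun a n r => bif n == 0 then (o a, v a 0, ni a) else
      (ar a ((r (node₁ n)).1, (r (node₂ n)).2.1, (r (node₃ n)).2.1),
        bif n % 2 == 1 then co a (n, (r (cellTy n)).1, (r (cellSub n)).2.2) else v a (n / 2),
        sn a (n, (r (node₁ n)).2.2, (r (node₃ n)).2.1)))
    (by fun_prop) ?_
  intro a n r hr
  rw [synRec]
  by_cases h : n = 0
  · simp [h]
  · have := node_lt h
    rw [hr _ (by omega : node₁ n < n), hr _ (by omega : node₂ n < n),
      hr _ (by omega : node₃ n < n)]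
    by_cases h' : n % 2 = 1
    · have := cell_lt h'
      rw [hr _ (by omega : cellTy n < n), hr _ (by omega : cellSub n < n)]
      simp [h, h', beq_false_of_ne h]
    · simp [h, h', beq_false_of_ne h, beq_false_of_ne h']

end Recursors
end Code

/-! ### Syntactic operations on numbers -/

section CodeNode

variable {I : Type} {c : I → ℕ}

open Code

theorem PreTy.code_arr (A : PreTy I) (t u : PreTm I) :
    (PreTy.arr A t u).code c = node (A.code c) (t.code c) (u.code c) := rfl

theorem PreSub.code_snoc (γ : PreSub I) (x : ℕ) (t : PreTm I) :
    (γ.snoc x t).code c = node (γ.code c) x (t.code c) := rfl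

theorem PreCtx.code_snoc (Γ : PreCtx I) (x : ℕ) (A : PreTy I) :
    (Γ.snoc x A).code c = node (Γ.code c) x (A.code c) := rfl

theorem PreTm.code_con (j : J) (γ : PreSub J) : (PreTm.con j γ).code J.code =
    cell j.ctx.code (j.ti.code J.code) (γ.code J.code) := by
  rw [PreTm.code, J.code_eq, cell]

end CodeNode

namespace Code

section

variable {α : Type} [Primcodable α]

/-- The dimension of a type. -/
def tyDim (n : ℕ) : ℕ := nodeRec (fun _ : Unit => 0) (fun _ p => p.2.1 + 1) () n

@[fun_prop] theorem primrec_tyDim {f : α → ℕ} (hf : Primrec f) :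
    Primrec fun a => tyDim (f a) :=
  (primrec_nodeRec (by fun_prop) (by fun_prop)).comp (g := fun a => ((), f a)) (by fun_prop)

/-- The length of a context. -/
def ctxLen (n : ℕ) : ℕ := nodeRec (fun _ : Unit => 0) (fun _ p => p.2.1 + 1) () n

@[fun_prop] theorem primrec_ctxLen {f : α → ℕ} (hf : Primrec f) :
    Primrec fun a => ctxLen (f a) :=
  (primrec_nodeRec (by fun_prop) (by fun_prop)).comp (g := fun a => ((), f a)) (by fun_prop)

/-- The dimension of a context. -/
def ctxDim (n : ℕ) : ℕ :=
  nodeRec (fun _ : Unit => 0) (fun _ p => max p.2.1 (tyDim (node₃ p.1))) () n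

@[fun_prop] theorem primrec_ctxDim {f : α → ℕ} (hf : Primrec f) :
    Primrec fun a => ctxDim (f a) :=
  (primrec_nodeRec (by fun_prop) (by fun_prop)).comp (g := fun a => ((), f a)) (by fun_prop)

/-- The variables of a context, in reverse order. -/
def ctxVars (n : ℕ) : List ℕ :=
  nodeRec (fun _ : Unit => []) (fun _ p => node₂ p.1 :: p.2.1) () n

@[fun_prop] theorem primrec_ctxVars {f : α → ℕ} (hf : Primrec f) :
    Primrec fun a => ctxVars (f a) :=
  (primrec_nodeRec (by fun_prop) (by fun_prop)).comp (g := fun a => ((), f a)) (by fun_prop)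

/-- Membership of `x : A` in a context, where `A` has the number `a`. -/
def mem (x a n : ℕ) : Bool :=
  nodeRec (fun _ : ℕ × ℕ => false)
    (fun q p => (q.1 == node₂ p.1 && q.2 == node₃ p.1) || p.2.1) (x, a) n

@[fun_prop] theorem primrec_mem {f g h : α → ℕ} (hf : Primrec f) (hg : Primrec g)
    (hh : Primrec h) : Primrec fun a => mem (f a) (g a) (h a) :=
  (primrec_nodeRec (by fun_prop) (by fun_prop)).comp (g := fun a => ((f a, g a), h a))
    (by fun_prop)

/-- The number of the term `x[γ]`, where `γ` has the number `n`. -/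
def lookup (x n : ℕ) : ℕ :=
  nodeRec (fun x : ℕ => 2 * x) (fun x p => bif x == node₂ p.1 then node₃ p.1 else p.2.1) x n

@[fun_prop] theorem primrec_lookup {f g : α → ℕ} (hf : Primrec f) (hg : Primrec g) :
    Primrec fun a => lookup (f a) (g a) :=
  (primrec_nodeRec (by fun_prop) (by fun_prop)).comp (g := fun a => (f a, g a)) (by fun_prop)

/-- The action of the substitution `s` on types, terms and substitutions. The index of a constructor
is closed and stays unchanged. -/
def subst (s n : ℕ) : ℕ × ℕ × ℕ :=
  synRec (fun _ => 0) (fun _ p => node p.1 p.2.1 p.2.2) (fun s x => lookup x s)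
    (fun _ p => cell (cellCtx p.1) (cellTy p.1) p.2.2) (fun _ => 0)
    (fun _ p => node p.2.1 (node₂ p.1) p.2.2) s n

@[fun_prop] theorem primrec_subst {f g : α → ℕ} (hf : Primrec f) (hg : Primrec g) :
    Primrec fun a => subst (f a) (g a) :=
  (primrec_synRec (by fun_prop) (by fun_prop) (by fun_prop) (by fun_prop) (by fun_prop)
    (by fun_prop)).comp (g := fun a => (f a, g a)) (by fun_prop)

/-- The variables of types, terms and substitutions. -/
def vars (n : ℕ) : List ℕ × List ℕ × List ℕ :=
  synRec (fun _ : Unit => []) (fun _ p => p.1 ++ p.2.1 ++ p.2.2) (fun _ x => [x])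
    (fun _ p => p.2.2) (fun _ => []) (fun _ p => p.2.1 ++ p.2.2) () n

@[fun_prop] theorem primrec_vars {f : α → ℕ} (hf : Primrec f) :
    Primrec fun a => vars (f a) :=
  (primrec_synRec (by fun_prop) (by fun_prop) (by fun_prop) (by fun_prop) (by fun_prop)
    (by fun_prop)).comp (g := fun a => ((), f a)) (by fun_prop)

/-- The two lists have the same elements. -/
def sameSet (l l' : List ℕ) : Bool := l.toFinset = l'.toFinset

theorem primrecRel_sameSet : PrimrecRel fun l l' : List ℕ => l.toFinset = l'.toFinset := by
  have h : PrimrecRel fun (l : List ℕ) (b : ℕ) => ∃ a ∈ l, a = b :=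
    PrimrecRel.exists_mem_list Primrec.eq
  have h' : PrimrecRel fun l l' : List ℕ => ∀ b ∈ l, ∃ a ∈ l', a = b :=
    PrimrecRel.forall_mem_list h.swap
  refine (PrimrecPred.and h' h'.swap).of_eq fun p => ?_
  simp only [exists_eq_right, Function.swap, Finset.ext_iff, List.mem_toFinset]
  exact ⟨fun h a => ⟨h.1 a, h.2 a⟩, fun h => ⟨fun a => (h a).1, fun a => (h a).2⟩⟩

@[fun_prop] theorem primrec_sameSet {f g : α → List ℕ} (hf : Primrec f) (hg : Primrec g) :
    Primrec fun a => sameSet (f a) (g a) :=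
  primrecRel_sameSet.decide.comp hf hg

end

section Spec

variable {I : Type} {c : I → ℕ}

theorem tyDim_code : ∀ A : PreTy I, tyDim (A.code c) = A.dim
  | .obj => nodeRec_zero _ _ _
  | .arr A t u => by
    rw [PreTy.code_arr, PreTy.dim, ← tyDim_code A, tyDim, nodeRec_node]
    rfl

theorem ctxLen_code : ∀ Γ : PreCtx I, ctxLen (Γ.code c) = Γ.length
  | .nil => nodeRec_zero _ _ _
  | .snoc Γ x A => by
    rw [PreCtx.code_snoc, PreCtx.length, ← ctxLen_code Γ, ctxLen, nodeRec_node]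
    rfl

theorem ctxDim_code : ∀ Γ : PreCtx I, ctxDim (Γ.code c) = Γ.dim
  | .nil => nodeRec_zero _ _ _
  | .snoc Γ x A => by
    rw [PreCtx.code_snoc, PreCtx.dim, ← ctxDim_code Γ, ctxDim, nodeRec_node, node₃_node,
      tyDim_code]
    rfl

theorem ctxVars_code : ∀ Γ : PreCtx I, (ctxVars (Γ.code c)).toFinset = Γ.vars
  | .nil => by
    rw [PreCtx.code, ctxVars, nodeRec_zero]
    rfl
  | .snoc Γ x A => by
    rw [PreCtx.code_snoc, PreCtx.vars, ← ctxVars_code Γ, ctxVars, nodeRec_node, node₂_node,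
      List.toFinset_cons, Finset.insert_eq, Finset.union_comm]
    rfl

theorem mem_code (hc : Function.Injective c) (x : ℕ) (A : PreTy I) :
    ∀ Γ : PreCtx I, mem x (A.code c) (Γ.code c) = true ↔ Nonempty (PreCtx.Mem x A Γ)
  | .nil => by
    rw [PreCtx.code, mem, nodeRec_zero]
    exact ⟨fun h => by simp at h, fun ⟨m⟩ => nomatch m⟩
  | .snoc Γ y B => by
    have ih := mem_code hc x A Γ
    rw [mem] at ih
    rw [PreCtx.code_snoc, mem, nodeRec_node, node₂_node, node₃_node]
    simp only [Bool.or_eq_true, Bool.and_eq_true, beq_iff_eq, ih]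
    constructor
    · rintro (⟨rfl, h⟩ | ⟨⟨m⟩⟩)
      · obtain rfl := PreTy.code_injective hc h
        exact ⟨.here⟩
      · exact ⟨.there m⟩
    · rintro ⟨_ | m⟩
      · exact .inl ⟨rfl, rfl⟩
      · exact .inr ⟨m⟩

theorem lookup_code (x : ℕ) :
    ∀ γ : PreSub I, lookup x (γ.code c) = (γ.lookup x).code c
  | .nil => nodeRec_zero _ _ _
  | .snoc γ y t => by
    have ih := lookup_code x γ
    rw [lookup] at ih
    rw [PreSub.code_snoc, lookup, nodeRec_node, node₂_node, node₃_node, ih, PreSub.lookup,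
      apply_ite (PreTm.code c)]
    by_cases h : x = y
    · simp [h]
    · simp [h, beq_false_of_ne h]

mutual
theorem subst_code_ty (δ : PreSub J) : ∀ A : PreTy J,
    (subst (δ.code J.code) (A.code J.code)).1 = (A.subst δ).code J.code
  | .obj => by rw [subst, PreTy.code, synRec_zero]; rfl
  | .arr A t u => by
    rw [PreTy.code_arr, PreTy.subst, PreTy.code_arr, ← subst_code_ty δ A, ← subst_code_tm δ t,
      ← subst_code_tm δ u, subst, synRec_node_ty]
    rfl

theorem subst_code_tm (δ : PreSub J) : ∀ t : PreTm J,
    (subst (δ.code J.code) (t.code J.code)).2.1 = (t.subst δ).code J.code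
  | .var x => by rw [PreTm.code, subst, synRec_var, lookup_code]; rfl
  | .con j γ => by
    rw [PreTm.code_con, PreTm.subst, PreTm.code_con, ← subst_code_sub δ γ, subst, synRec_cell,
      cellCtx_cell, cellTy_cell]
    rfl

theorem subst_code_sub (δ : PreSub J) : ∀ γ : PreSub J,
    (subst (δ.code J.code) (γ.code J.code)).2.2 = (γ.comp δ).code J.code
  | .nil => by rw [subst, PreSub.code, synRec_zero]; rfl
  | .snoc γ x t => by
    rw [PreSub.code_snoc, PreSub.comp, PreSub.code_snoc, ← subst_code_sub δ γ,
      ← subst_code_tm δ t, subst, synRec_node_sub, node₂_node]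
    rfl
end

mutual
theorem vars_code_ty : ∀ A : PreTy J, (vars (A.code J.code)).1.toFinset = A.vars
  | .obj => by rw [vars, PreTy.code, synRec_zero]; rfl
  | .arr A t u => by
    rw [PreTy.code_arr, PreTy.vars, ← vars_code_ty A, ← vars_code_tm t, ← vars_code_tm u, vars,
      synRec_node_ty, ← List.toFinset_append, ← List.toFinset_append]
    rfl

theorem vars_code_tm : ∀ t : PreTm J, (vars (t.code J.code)).2.1.toFinset = t.vars
  | .var x => by rw [PreTm.code, vars, synRec_var]; rfl
  | .con j γ => by
    rw [PreTm.code_con, PreTm.vars, ← vars_code_sub γ, vars, synRec_cell]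
    rfl

theorem vars_code_sub : ∀ γ : PreSub J, (vars (γ.code J.code)).2.2.toFinset = γ.vars
  | .nil => by rw [vars, PreSub.code, synRec_zero]; rfl
  | .snoc γ x t => by
    rw [PreSub.code_snoc, PreSub.vars, ← vars_code_sub γ, ← vars_code_tm t, vars,
      synRec_node_sub, ← List.toFinset_append]
    rfl
end

end Spec

end Code

/-! ### Recognising ps-contexts and raw expressions -/

namespace Code

section

variable {α : Type} [Primcodable α]

/-- `(x, a)` is one of the pairs that steps `psd` reach from a variable whose type has the number
`n`, after at least one step. -/
def inTail (x a n : ℕ) : Bool :=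
  nodeRec (fun _ : ℕ × ℕ => false)
    (fun q p => (2 * q.1 == node₃ p.1 && q.2 == node₁ p.1) || p.2.1) (x, a) n

@[fun_prop] theorem primrec_inTail {f g h : α → ℕ} (hf : Primrec f) (hg : Primrec g)
    (hh : Primrec h) : Primrec fun a => inTail (f a) (g a) (h a) :=
  (primrec_nodeRec (by fun_prop) (by fun_prop)).comp (g := fun a => ((f a, g a), h a))
    (by fun_prop)

/-- For the number `n` of a ps-context `Γ`, this is the judgement `Γ ⊢ps x : A`, where `A` has the
number `a`: the pair `(x, a)` is reached from the last variable of `Γ`. -/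
def inChain (x a n : ℕ) : Bool := (x == node₂ n && a == node₃ n) || inTail x a (node₃ n)

@[fun_prop] theorem primrec_inChain {f g h : α → ℕ} (hf : Primrec f) (hg : Primrec g)
    (hh : Primrec h) : Primrec fun a => inChain (f a) (g a) (h a) := by
  unfold inChain; fun_prop

/-- The number of a ps-context. The last two variables of a ps-context determine the last step `pse`
of its derivations, which is checked here for two entries at a time. -/
def isPs (n : ℕ) : Bool :=
  nodeRec (fun _ : Unit => false)
    (fun _ p => p.1 == node 0 0 0 ||
      (p.2.2 && node₂ (node₁ p.1) == ctxLen (node₁ (node₁ p.1)) &&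
        node₂ p.1 == node₂ (node₁ p.1) + 1 &&
        node₃ p.1 == node (node₃ (node₁ p.1)) (2 * (node₂ (node₃ p.1) / 2))
          (2 * node₂ (node₁ p.1)) &&
        inChain (node₂ (node₃ p.1) / 2) (node₃ (node₁ p.1)) (node₁ (node₁ p.1)))) () n

@[fun_prop] theorem primrec_isPs {f : α → ℕ} (hf : Primrec f) : Primrec fun a => isPs (f a) :=
  (primrec_nodeRec (by fun_prop) (by fun_prop)).comp (g := fun a => ((), f a)) (by fun_prop)

/-- The list of variables of the `i`-source of a ps-context. As the last step `pse` of a ps-context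
adds two entries, the recursion goes down by two entries at a time, and the case of a single entry is
the rule `pss`. -/
def src (i n : ℕ) : List ℕ :=
  nodeRec (fun _ : ℕ => [])
    (fun i p => bif node₁ p.1 == 0 then bif i == 0 then [] else [0]
      else bif Nat.ble i (tyDim (node₃ (node₁ p.1)) + 1) then p.2.2
      else node₂ p.1 :: node₂ (node₁ p.1) :: p.2.2) i n

@[fun_prop] theorem primrec_src {f g : α → ℕ} (hf : Primrec f) (hg : Primrec g) :
    Primrec fun a => src (f a) (g a) :=
  (primrec_nodeRec (by fun_prop) (by fun_prop)).comp (g := fun a => (f a, g a)) (by fun_prop)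

/-- The list of variables of the `i`-target of a ps-context, computed like `src`. -/
def tgt (i n : ℕ) : List ℕ :=
  nodeRec (fun _ : ℕ => [])
    (fun i p => bif node₁ p.1 == 0 then bif i == 0 then [] else [0]
      else bif Nat.ble i (tyDim (node₃ (node₁ p.1)) + 1) then
        bif i == tyDim (node₃ (node₁ p.1)) + 1 then node₂ (node₁ p.1) :: p.2.2.tail else p.2.2
      else node₂ p.1 :: node₂ (node₁ p.1) :: p.2.2) i n

@[fun_prop] theorem primrec_tgt {f g : α → ℕ} (hf : Primrec f) (hg : Primrec g) :
    Primrec fun a => tgt (f a) (g a) :=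
  (primrec_nodeRec (by fun_prop) (by fun_prop)).comp (g := fun a => (f a, g a)) (by fun_prop)

/-- The type `a` is full in the ps-context `n`. -/
def full (n a : ℕ) : Bool :=
  (!(a == 0) &&
    sameSet (src (ctxDim n) n) ((vars (node₁ a)).1 ++ (vars (node₂ a)).2.1) &&
    sameSet (tgt (ctxDim n) n) ((vars (node₁ a)).1 ++ (vars (node₃ a)).2.1)) ||
  sameSet (ctxVars n) (vars a).1

@[fun_prop] theorem primrec_full {f g : α → ℕ} (hf : Primrec f) (hg : Primrec g) :
    Primrec fun a => full (f a) (g a) := by unfold full; fun_prop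

/-- The number of a raw type, a raw term, a raw substitution over `J`. -/
def isSyn (n : ℕ) : Bool × Bool × Bool :=
  synRec (fun _ : Unit => true) (fun _ p => p.1 && p.2.1 && p.2.2) (fun _ _ => true)
    (fun _ p => isPs (cellCtx p.1) && full (cellCtx p.1) (cellTy p.1) && p.2.1 && p.2.2)
    (fun _ => true) (fun _ p => p.2.1 && p.2.2) () n

@[fun_prop] theorem primrec_isSyn {f : α → ℕ} (hf : Primrec f) : Primrec fun a => isSyn (f a) :=
  (primrec_synRec (by fun_prop) (by fun_prop) (by fun_prop) (by fun_prop) (by fun_prop)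
    (by fun_prop)).comp (g := fun a => ((), f a)) (by fun_prop)

/-- The number of a raw context over `J`. -/
def isCtx (n : ℕ) : Bool :=
  nodeRec (fun _ : Unit => true) (fun _ p => p.2.1 && (isSyn (node₃ p.1)).1) () n

@[fun_prop] theorem primrec_isCtx {f : α → ℕ} (hf : Primrec f) : Primrec fun a => isCtx (f a) :=
  (primrec_nodeRec (by fun_prop) (by fun_prop)).comp (g := fun a => ((), f a)) (by fun_prop)

end

section Spec

variable {c : Empty → ℕ}

theorem inTail_node (x a p q r : ℕ) :
    inTail x a (node p q r) = ((2 * x == r && a == p) || inTail x a p) := by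
  rw [inTail, nodeRec_node, node₁_node, node₃_node]
  rfl

theorem inTail_zero (x a : ℕ) : inTail x a 0 = false := nodeRec_zero _ _ _

/-- The pairs reached by steps `psd` are closed under such steps. -/
theorem inTail_trans {f x p q : ℕ} {B : PreTy Empty}
    (h : inTail f (node p q (2 * x)) (B.code c) = true) : inTail x p (B.code c) = true := by
  match B, h with
  | .obj, h => rw [PreTy.code, inTail_zero] at h; cases h
  | .arr A t u, h =>
    rw [PreTy.code_arr, inTail_node, Bool.or_eq_true, Bool.and_eq_true, beq_iff_eq,
      beq_iff_eq] at h
    rw [PreTy.code_arr, inTail_node, Bool.or_eq_true]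
    obtain ⟨-, h⟩ | h := h
    · rw [← h, inTail_node]
      exact .inr (by simp)
    · exact .inr (inTail_trans h)

theorem inChain_snoc (x a : ℕ) (Γ : PreCtx Empty) (y : ℕ) (B : PreTy Empty) :
    inChain x a ((Γ.snoc y B).code c) =
      ((x == y && a == B.code c) || inTail x a (B.code c)) := by
  rw [inChain, PreCtx.code_snoc, node₂_node, node₃_node]

theorem inChain_psd {f x p q : ℕ} : {Γ : PreCtx Empty} →
    inChain f (node p q (2 * x)) (Γ.code c) = true → inChain x p (Γ.code c) = true
  | .nil, h => by
    simp [inChain, PreCtx.code, node₃, inTail_zero] at h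
  | .snoc Γ y B, h => by
    rw [inChain_snoc, Bool.or_eq_true, Bool.and_eq_true, beq_iff_eq, beq_iff_eq] at h
    rw [inChain_snoc, Bool.or_eq_true]
    obtain ⟨-, h⟩ | h := h
    · rw [← h, inTail_node]
      exact .inr (by simp)
    · exact .inr (inTail_trans h)

theorem isPs_node (x y w : ℕ) : isPs (node x y w) = (node x y w == node 0 0 0 ||
      (isPs (node₁ x) && node₂ x == ctxLen (node₁ x) && y == node₂ x + 1 &&
        w == node (node₃ x) (2 * (node₂ w / 2)) (2 * node₂ x) &&
        inChain (node₂ w / 2) (node₃ x) (node₁ x))) := by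
  rw [isPs, nodeRec_node, node₁_node, node₂_node, node₃_node]
  rfl

theorem inChain_of_psAux : {Γ : PreCtx Empty} → {x : ℕ} → {A : PreTy Empty} → PsAux Γ x A →
    isPs (Γ.code c) = true ∧ inChain x (A.code c) (Γ.code c) = true
  | _, _, _, .pss => by
    refine ⟨?_, by rw [inChain_snoc]; simp⟩
    rw [PreCtx.code_snoc, isPs_node]
    simp [PreCtx.code, PreTy.code]
  | _, _, _, .psd d => by
    obtain ⟨h, h'⟩ := inChain_of_psAux d
    exact ⟨h, inChain_psd h'⟩
  | _, _, _, .pse (Γ := Γ) d hl => by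
    obtain ⟨h, h'⟩ := inChain_of_psAux d
    refine ⟨?_, by rw [inChain_snoc]; simp⟩
    simp [PreCtx.code_snoc, isPs_node, PreTy.code_arr, h, h', hl, ctxLen_code, PreTm.code]

theorem exists_psAux_of_inTail {Γ : PreCtx Empty} {x a : ℕ} : {y : ℕ} → {B : PreTy Empty} →
    PsAux Γ y B → inTail x a (B.code c) = true →
    ∃ A : PreTy Empty, A.code c = a ∧ Nonempty (PsAux Γ x A)
  | _, .obj, _, h => by rw [PreTy.code, inTail_zero] at h; cases h
  | _, .arr A (.var z) (.var z'), d, h => by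
    rw [PreTy.code_arr, inTail_node, Bool.or_eq_true, Bool.and_eq_true, beq_iff_eq,
      beq_iff_eq, PreTm.code] at h
    obtain ⟨h, h'⟩ | h := h
    · obtain rfl : x = z' := by omega
      exact ⟨A, h'.symm, ⟨.psd d⟩⟩
    · exact exists_psAux_of_inTail (.psd d) h

theorem exists_psAux_of_isPs (n : ℕ) (h : isPs n = true) : ∃ Γ : PreCtx Empty, Γ.code c = n ∧
    ∀ x a, inChain x a n = true → ∃ A : PreTy Empty, A.code c = a ∧ Nonempty (PsAux Γ x A) := by
  have key : ∀ {Γ : PreCtx Empty} {y : ℕ} {B : PreTy Empty}, PsAux (Γ.snoc y B) y B →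
      ∀ x a, inChain x a ((Γ.snoc y B).code c) = true →
      ∃ A : PreTy Empty, A.code c = a ∧ Nonempty (PsAux (Γ.snoc y B) x A) := by
    intro Γ y B d x a h
    rw [inChain_snoc, Bool.or_eq_true, Bool.and_eq_true, beq_iff_eq, beq_iff_eq] at h
    obtain ⟨rfl, h⟩ | h := h
    · exact ⟨B, h.symm, ⟨d⟩⟩
    · exact exists_psAux_of_inTail d h
  by_cases h0 : n = 0
  · rw [h0, isPs, nodeRec_zero] at h
    cases h
  · rw [← node_eta h0, isPs_node, Bool.or_eq_true, beq_iff_eq, node_eta h0] at h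
    obtain h | h := h
    · have e : (PreCtx.nil.snoc 0 .obj : PreCtx Empty).code c = node 0 0 0 := rfl
      rw [h, ← e]
      exact ⟨_, rfl, key .pss⟩
    · simp only [Bool.and_eq_true, beq_iff_eq] at h
      obtain ⟨⟨⟨⟨h, h₁⟩, h₂⟩, h₃⟩, h₄⟩ := h
      have hlt := node₁_node₁_lt h0
      obtain ⟨Γ, hΓ, hps⟩ := exists_psAux_of_isPs _ h
      obtain ⟨A, hA, ⟨d⟩⟩ := hps _ _ h₄
      -- Otherwise `node₁ (node₁ n)` is the junk value `0`, which is not the number of a ps-context.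
      have h1 : node₁ n ≠ 0 := by
        intro h1
        rw [h1, show node₁ 0 = 0 by simp [node₁], isPs, nodeRec_zero] at h
        cases h
      rw [← hΓ, ctxLen_code] at h₁
      have e : ((Γ.snoc (node₂ (node₁ n)) A).snoc (node₂ (node₁ n) + 1)
          (.arr A (.var (node₂ (node₃ n) / 2)) (.var (node₂ (node₁ n))))).code c = n := by
        rw [PreCtx.code_snoc, PreCtx.code_snoc, PreTy.code_arr, PreTm.code, PreTm.code, hΓ, hA,
          ← h₃, ← h₂, node_eta h1, node_eta h0]
      refine ⟨_, e, fun x a hx => ?_⟩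
      rw [← e] at hx
      exact key (.pse d h₁) x a hx
termination_by n

/-- Further steps `psd` reach an object. -/
theorem ps_of_psAux {Γ : PreCtx Empty} : ∀ {x : ℕ} {A : PreTy Empty}, PsAux Γ x A → Nonempty (Ps Γ)
  | _, .obj, d => ⟨.ps d⟩
  | _, .arr _ (.var _) (.var _), d => ps_of_psAux (.psd d)

theorem isPs_iff (n : ℕ) : isPs n = true ↔ ∃ Γ : PsCtx, Γ.code = n := by
  constructor
  · intro h
    obtain ⟨Γ, hΓ, h⟩ := exists_psAux_of_isPs (c := fun i => i.elim) n h
    obtain ⟨A, -, ⟨d⟩⟩ := h (node₂ n) (node₃ n) (by simp [inChain])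
    obtain ⟨d⟩ := ps_of_psAux d
    exact ⟨⟨Γ, d⟩, hΓ⟩
  · rintro ⟨⟨Γ, ⟨d⟩⟩, rfl⟩
    exact (inChain_of_psAux d).1

theorem src_code (i : ℕ) : {Γ : PreCtx Empty} → {x : ℕ} → {A : PreTy Empty} →
    (d : PsAux Γ x A) → src i (Γ.code c) = d.src i
  | _, _, _, .pss => by
    rw [PreCtx.code_snoc, src, nodeRec_node, node₁_node]
    by_cases h : i = 0 <;> simp [PreCtx.code, PsAux.src, h, beq_false_of_ne]
  | _, _, _, .psd d => src_code i d
  | _, _, _, .pse (Γ := Γ) (l := l) (A := A) d h => by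
    have ih := src_code i d
    rw [src] at ih
    rw [PreCtx.code_snoc, PreCtx.code_snoc, src, nodeRec_node]
    simp only [node₁_node, node₂_node, node₃_node, ih, tyDim_code, PsAux.src,
      beq_false_of_ne (node_ne_zero _ _ _), cond_false]
    by_cases h' : i ≤ A.dim + 1
    · simp [h', Nat.ble_eq_true_of_le h']
    · simp [h', Bool.eq_false_iff.2 fun e => h' (Nat.le_of_ble_eq_true e)]

theorem tgt_code (i : ℕ) : {Γ : PreCtx Empty} → {x : ℕ} → {A : PreTy Empty} →
    (d : PsAux Γ x A) → tgt i (Γ.code c) = d.tgt i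
  | _, _, _, .pss => by
    rw [PreCtx.code_snoc, tgt, nodeRec_node, node₁_node]
    by_cases h : i = 0 <;> simp [PreCtx.code, PsAux.tgt, h, beq_false_of_ne]
  | _, _, _, .psd d => tgt_code i d
  | _, _, _, .pse (Γ := Γ) (l := l) (A := A) d h => by
    have ih := tgt_code i d
    rw [tgt] at ih
    rw [PreCtx.code_snoc, PreCtx.code_snoc, tgt, nodeRec_node]
    simp only [node₁_node, node₂_node, node₃_node, ih, tyDim_code, PsAux.tgt,
      beq_false_of_ne (node_ne_zero _ _ _), cond_false]
    by_cases h' : i ≤ A.dim + 1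
    · by_cases h'' : i = A.dim + 1
      · simp [h'', Nat.ble_eq_true_of_le]
      · simp [h', h'', Nat.ble_eq_true_of_le h', beq_false_of_ne]
    · simp [h', Bool.eq_false_iff.2 fun e => h' (Nat.le_of_ble_eq_true e)]

theorem sameSet_iff (l l' : List ℕ) : sameSet l l' = true ↔ l.toFinset = l'.toFinset :=
  decide_eq_true_iff

theorem full_code (Γ : PsCtx) (A : PreTy J) :
    full Γ.code (A.code J.code) = true ↔ A.FullIn Γ := by
  have hs : (src (ctxDim Γ.code) Γ.code).toFinset = Γ.src := by
    obtain ⟨Γ, ⟨d⟩⟩ := Γ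
    rw [PsCtx.code, ctxDim_code, src_code _ d, PsCtx.src]
  have ht : (tgt (ctxDim Γ.code) Γ.code).toFinset = Γ.tgt := by
    obtain ⟨Γ, ⟨d⟩⟩ := Γ
    rw [PsCtx.code, ctxDim_code, tgt_code _ d, PsCtx.tgt]
  have hv : (ctxVars Γ.code).toFinset = Γ.ctx.vars := ctxVars_code _
  simp only [full, Bool.or_eq_true, Bool.and_eq_true, sameSet_iff, hs, ht, hv, vars_code_ty,
    List.toFinset_append]
  constructor
  · rintro (⟨⟨h, h₁⟩, h₂⟩ | h)
    · obtain _ | ⟨A, t, u⟩ := A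
      · simp [PreTy.code] at h
      · rw [PreTy.code_arr, node₁_node, node₂_node, vars_code_ty, vars_code_tm] at h₁
        rw [PreTy.code_arr, node₁_node, node₃_node, vars_code_ty, vars_code_tm] at h₂
        exact .op h₁ h₂
    · exact .coh h
  · rintro (⟨h₁, h₂⟩ | h)
    · rw [PreTy.code_arr, node₁_node, node₂_node, node₃_node, vars_code_ty, vars_code_tm,
        vars_code_tm]
      exact .inl ⟨⟨by simp, h₁⟩, h₂⟩
    · exact .inr h

/-- Full types are the types of indices. -/
theorem exists_index {Γ : PsCtx} {A : PreTy J} (h : A.FullIn Γ) :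
    ∃ j : J, j.ctx = Γ ∧ j.ti = A := by
  have e := J.equiv.apply_symm_apply ⟨(Γ, A), h⟩
  have e := Prod.ext_iff.1 (Subtype.ext_iff.1 e)
  exact ⟨J.equiv.symm ⟨(Γ, A), h⟩, e⟩

theorem isSyn_zero : isSyn 0 = (true, true, true) := synRec_zero _ _ _ _ _ _ _

theorem isSyn_node_ty (x y w : ℕ) :
    (isSyn (node x y w)).1 = ((isSyn x).1 && (isSyn y).2.1 && (isSyn w).2.1) :=
  synRec_node_ty _ _ _ _ _ _ _ _ _ _

theorem isSyn_node_sub (x y w : ℕ) :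
    (isSyn (node x y w)).2.2 = ((isSyn x).2.2 && (isSyn w).2.1) :=
  synRec_node_sub _ _ _ _ _ _ _ _ _ _

theorem isSyn_var (x : ℕ) : (isSyn (2 * x)).2.1 = true := synRec_var _ _ _ _ _ _ _ _

theorem isSyn_cell (x y w : ℕ) : (isSyn (cell x y w)).2.1 =
    (isPs x && full x y && (isSyn y).1 && (isSyn w).2.2) := by
  rw [isSyn, synRec_cell, cellCtx_cell, cellTy_cell]
  rfl

/-- The test for numbers of raw expressions is correct. The induction is on numbers and not on
expressions, as the type in the index of a constructor is not a subexpression in the syntax over `J`,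
while its number is smaller. -/
theorem isSyn_iff (n : ℕ) : ((isSyn n).1 = true ↔ ∃ A : PreTy J, A.code J.code = n) ∧
    ((isSyn n).2.1 = true ↔ ∃ t : PreTm J, t.code J.code = n) ∧
    ((isSyn n).2.2 = true ↔ ∃ γ : PreSub J, γ.code J.code = n) := by
  induction n using Nat.strong_induction_on with
  | _ n ih =>
  refine ⟨?_, ?_, ?_⟩
  · by_cases h : n = 0
    · simp only [h, isSyn_zero, true_iff]
      exact ⟨.obj, rfl⟩
    · have hlt := node_lt h
      rw [← node_eta h, isSyn_node_ty, Bool.and_eq_true, Bool.and_eq_true,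
        (ih _ (by omega)).1, (ih (node₂ n) (by omega)).2.1, (ih (node₃ n) (by omega)).2.1]
      constructor
      · rintro ⟨⟨⟨A, hA⟩, t, ht⟩, u, hu⟩
        exact ⟨.arr A t u, by rw [PreTy.code_arr, hA, ht, hu]⟩
      · rintro ⟨_ | ⟨A, t, u⟩, e⟩
        · exact (node_ne_zero _ _ _ e.symm).elim
        · rw [node_eta h] at e
          rw [← e, PreTy.code_arr, node₁_node, node₂_node, node₃_node]
          exact ⟨⟨⟨A, rfl⟩, t, rfl⟩, u, rfl⟩
  · rcases Nat.mod_two_eq_zero_or_one n with h | h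
    · rw [show n = 2 * (n / 2) by omega, isSyn_var]
      simp only [true_iff]
      exact ⟨.var (n / 2), rfl⟩
    · have hlt := cell_lt h
      rw [← cell_eta h, isSyn_cell, Bool.and_eq_true, Bool.and_eq_true, Bool.and_eq_true,
        isPs_iff, (ih _ (by omega)).1, (ih (cellSub n) (by omega)).2.2]
      constructor
      · rintro ⟨⟨⟨⟨Γ, hΓ⟩, hf⟩, A, hA⟩, γ, hγ⟩
        rw [← hΓ, ← hA, full_code] at hf
        obtain ⟨j, rfl, rfl⟩ := exists_index hf
        exact ⟨.con j γ, by rw [PreTm.code_con, hΓ, hA, hγ]⟩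
      · rintro ⟨x | ⟨j, γ⟩, e⟩
        · have := cell_mod_two (cellCtx n) (cellTy n) (cellSub n)
          rw [← e, PreTm.code] at this
          omega
        · rw [cell_eta h] at e
          rw [← e, PreTm.code_con, cellCtx_cell, cellTy_cell, cellSub_cell, full_code]
          exact ⟨⟨⟨⟨_, rfl⟩, (J.equiv j).2⟩, _, rfl⟩, γ, rfl⟩
  · by_cases h : n = 0
    · simp only [h, isSyn_zero, true_iff]
      exact ⟨.nil, rfl⟩
    · have hlt := node_lt h
      rw [← node_eta h, isSyn_node_sub, Bool.and_eq_true, (ih _ (by omega)).2.2,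
        (ih (node₃ n) (by omega)).2.1]
      constructor
      · rintro ⟨⟨γ, hγ⟩, t, ht⟩
        exact ⟨.snoc γ (node₂ n) t, by rw [PreSub.code_snoc, hγ, ht]⟩
      · rintro ⟨_ | ⟨γ, x, t⟩, e⟩
        · exact (node_ne_zero _ _ _ e.symm).elim
        · rw [node_eta h] at e
          rw [← e, PreSub.code_snoc, node₁_node, node₃_node]
          exact ⟨⟨γ, rfl⟩, t, rfl⟩

theorem isCtx_iff (n : ℕ) : isCtx n = true ↔ ∃ Γ : PreCtx J, Γ.code J.code = n := by
  induction n using Nat.strong_induction_on with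
  | _ n ih =>
  by_cases h : n = 0
  · rw [h, isCtx, nodeRec_zero]
    simp only [true_iff]
    exact ⟨.nil, rfl⟩
  · have hlt := node_lt h
    have ih := ih _ (show node₁ n < n by omega)
    rw [isCtx] at ih
    rw [← node_eta h, isCtx, nodeRec_node, Bool.and_eq_true, node₃_node, ih, (isSyn_iff _).1]
    constructor
    · rintro ⟨⟨Γ, hΓ⟩, A, hA⟩
      exact ⟨.snoc Γ (node₂ n) A, by rw [PreCtx.code_snoc, hΓ, hA]⟩
    · rintro ⟨_ | ⟨Γ, x, A⟩, e⟩
      · exact (node_ne_zero _ _ _ e.symm).elim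
      · rw [node_eta h] at e
        rw [← e, PreCtx.code_snoc, node₁_node, node₃_node]
        exact ⟨⟨Γ, rfl⟩, A, rfl⟩

end Spec

end Code

/-! ### Inversion of the derivation rules -/

section Inversion

variable {I : Type} {S : Signature I} {Γ Δ : PreCtx I} {A B : PreTy I} {t u : PreTm I}
  {γ : PreSub I} {x y : ℕ}

theorem nonempty_ctxD_snoc : Nonempty (CtxD S (Γ.snoc x A)) ↔
    x = Γ.length ∧ Nonempty (CtxD S Γ) ∧ Nonempty (TyD S Γ A) :=
  ⟨fun ⟨.cc c d h⟩ => ⟨h, ⟨c⟩, ⟨d⟩⟩, fun ⟨h, ⟨c⟩, ⟨d⟩⟩ => ⟨.cc c d h⟩⟩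

theorem nonempty_tyD_obj : Nonempty (TyD S Γ .obj) ↔ Nonempty (CtxD S Γ) :=
  ⟨fun ⟨.ob c⟩ => ⟨c⟩, fun ⟨c⟩ => ⟨.ob c⟩⟩

theorem nonempty_tyD_arr : Nonempty (TyD S Γ (.arr A t u)) ↔
    Nonempty (TmD S Γ t A) ∧ Nonempty (TmD S Γ u A) :=
  ⟨fun ⟨.ar d e⟩ => ⟨⟨d⟩, ⟨e⟩⟩, fun ⟨⟨d⟩, ⟨e⟩⟩ => ⟨.ar d e⟩⟩

theorem nonempty_tmD_var : Nonempty (TmD S Γ (.var x) A) ↔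
    Nonempty (PreCtx.Mem x A Γ) ∧ Nonempty (CtxD S Γ) :=
  ⟨fun ⟨.var c m⟩ => ⟨⟨m⟩, ⟨c⟩⟩, fun ⟨⟨m⟩, ⟨c⟩⟩ => ⟨.var c m⟩⟩

theorem nonempty_tmD_con {i : I} : Nonempty (TmD S Δ (.con i γ) A) ↔
    A = (S.Ti i).subst γ ∧ Nonempty (TyD S ((S.Ci i).lift I) (S.Ti i)) ∧
      Nonempty (SubD S Δ γ ((S.Ci i).lift I)) :=
  ⟨fun ⟨.con d g h⟩ => ⟨h, ⟨d⟩, ⟨g⟩⟩, fun ⟨h, ⟨d⟩, ⟨g⟩⟩ => ⟨.con d g h⟩⟩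

theorem nonempty_subD_nil : Nonempty (SubD S Δ .nil .nil) ↔ Nonempty (CtxD S Δ) :=
  ⟨fun ⟨.es c⟩ => ⟨c⟩, fun ⟨c⟩ => ⟨.es c⟩⟩

theorem nonempty_subD_snoc : Nonempty (SubD S Δ (γ.snoc y t) (Γ.snoc x A)) ↔
    x = y ∧ Nonempty (SubD S Δ γ Γ) ∧ Nonempty (CtxD S (Γ.snoc x A)) ∧
      Nonempty (TmD S Δ t (A.subst γ)) :=
  ⟨fun ⟨.sc g c d h⟩ => ⟨h, ⟨g⟩, ⟨c⟩, ⟨d⟩⟩, fun ⟨h, ⟨g⟩, ⟨c⟩, ⟨d⟩⟩ => ⟨.sc g c d h⟩⟩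

end Inversion

/-! ### The type checker -/

namespace Code

/-- A judgement with numbers in place of the raw objects is given by a tag and three numbers:
`(0, Γ, _, _)` stands for `Γ ⊢`, `(1, Γ, A, _)` for `Γ ⊢ A`, `(2, Γ, t, A)` for `Γ ⊢ t : A`, and
`(k, Δ, γ, Γ)` with `3 ≤ k` for `Δ ⊢ γ : Γ`. -/
def Derivable : ℕ × ℕ × ℕ × ℕ → Prop
  | (0, n, _, _) => ∃ Γ : PreCtx J, Γ.code J.code = n ∧ Nonempty (CtxD CaTT.toSignature Γ)
  | (1, n, a, _) => ∃ (Γ : PreCtx J) (A : PreTy J), (Γ.code J.code = n ∧ A.code J.code = a) ∧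
      Nonempty (TyD CaTT.toSignature Γ A)
  | (2, n, m, a) => ∃ (Γ : PreCtx J) (t : PreTm J) (A : PreTy J),
      (Γ.code J.code = n ∧ t.code J.code = m ∧ A.code J.code = a) ∧
      Nonempty (TmD CaTT.toSignature Γ t A)
  | (_ + 3, n, m, l) => ∃ (Δ Γ : PreCtx J) (γ : PreSub J),
      (Δ.code J.code = n ∧ Γ.code J.code = l ∧ γ.code J.code = m) ∧
      Nonempty (SubD CaTT.toSignature Δ γ Γ)

/-- The premises of the only rule that can derive a judgement. -/
def premises (q : ℕ × ℕ × ℕ × ℕ) : List (ℕ × ℕ × ℕ × ℕ) :=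
  bif q.1 == 0 then
    bif q.2.1 == 0 then [] else [(0, node₁ q.2.1, 0, 0), (1, node₁ q.2.1, node₃ q.2.1, 0)]
  else bif q.1 == 1 then
    bif q.2.2.1 == 0 then [(0, q.2.1, 0, 0)]
    else [(2, q.2.1, node₂ q.2.2.1, node₁ q.2.2.1), (2, q.2.1, node₃ q.2.2.1, node₁ q.2.2.1)]
  else bif q.1 == 2 then
    bif q.2.2.1 % 2 == 1 then
      [(1, cellCtx q.2.2.1, cellTy q.2.2.1, 0), (3, q.2.1, cellSub q.2.2.1, cellCtx q.2.2.1)]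
    else [(0, q.2.1, 0, 0)]
  else
    bif q.2.2.1 == 0 then [(0, q.2.1, 0, 0)]
    else [(3, q.2.1, node₁ q.2.2.1, node₁ q.2.2.2), (0, q.2.2.2, 0, 0),
      (2, q.2.1, node₃ q.2.2.1, (subst (node₁ q.2.2.1) (node₃ q.2.2.2)).1)]

/-- The side conditions of the only rule that can derive a judgement, and the condition that the
numbers are numbers of raw objects. -/
def side (q : ℕ × ℕ × ℕ × ℕ) : Bool :=
  isCtx q.2.1 &&
    bif q.1 == 0 then
      (q.2.1 == 0 || node₂ q.2.1 == ctxLen (node₁ q.2.1))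
    else bif q.1 == 1 then (isSyn q.2.2.1).1
    else bif q.1 == 2 then (isSyn q.2.2.1).2.1 && (isSyn q.2.2.2).1 &&
      bif q.2.2.1 % 2 == 1 then q.2.2.2 == (subst (cellSub q.2.2.1) (cellTy q.2.2.1)).1
      else mem (q.2.2.1 / 2) q.2.2.2 q.2.1
    else (isSyn q.2.2.1).2.2 && isCtx q.2.2.2 &&
      bif q.2.2.1 == 0 then q.2.2.2 == 0
      else !(q.2.2.2 == 0) && node₂ q.2.2.2 == node₂ q.2.2.1

/-- The size of a judgement. The type `A` does not contribute to the size of `Γ ⊢ t : A`, since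
the premises of `Δ ⊢ γ : Γ` contain substituted types whose numbers are not bounded by the number of
the conclusion. The factor `2` and the summand `1` make `Γ ⊢` smaller than all other judgements over
`Γ`. -/
def size (q : ℕ × ℕ × ℕ × ℕ) : ℕ :=
  bif q.1 == 0 then 2 * q.2.1
  else bif q.1 == 1 || q.1 == 2 then 2 * (q.2.1 + q.2.2.1) + 1
  else 2 * (q.2.1 + q.2.2.1 + q.2.2.2) + 1

theorem primrec_premises : Primrec premises := by unfold premises; fun_prop
theorem primrec_side : Primrec side := by unfold side; fun_prop
theorem primrec_size : Primrec size := by unfold size; fun_prop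

theorem size_lt_of_mem_premises {q q' : ℕ × ℕ × ℕ × ℕ} (h : q' ∈ premises q) :
    size q' < size q := by
  obtain ⟨k, n, m, l⟩ := q
  match k with
  | 0 =>
    by_cases hn : n = 0
    · simp [premises, hn] at h
    · have := node_lt hn
      simp only [premises, beq_self_eq_true, beq_false_of_ne hn, cond_true, cond_false,
        List.mem_cons, List.not_mem_nil, or_false] at h
      obtain rfl | rfl := h <;> simp [size] <;> omega
  | 1 =>
    by_cases hm : m = 0
    · simp [premises, hm] at h
      subst h
      simp [size]
    · have := node_lt hm
      simp [premises, beq_false_of_ne hm] at h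
      obtain rfl | rfl := h <;> simp [size] <;> omega
  | 2 =>
    rcases Nat.mod_two_eq_zero_or_one m with hm | hm
    · simp [premises, hm] at h
      subst h
      simp [size]
    · have := cell_lt hm
      simp [premises, hm] at h
      obtain rfl | rfl := h <;> simp [size] <;> omega
  | k + 3 =>
    have hs : size (k + 3, n, m, l) = 2 * (n + m + l) + 1 := by
      simp [size]
    by_cases hm : m = 0
    · simp [premises, hm] at h
      subst h
      rw [hs]
      simp [size]
      omega
    · have := node_lt hm
      simp [premises, beq_false_of_ne hm] at h
      rw [hs]
      have : node₁ l ≤ l := (Nat.unpair_left_le _).trans (Nat.sub_le _ _)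
      obtain rfl | rfl | rfl := h <;> simp [size] <;> omega

theorem derivable_ctx {Γ : PreCtx J} {x y : ℕ} :
    Derivable (0, Γ.code J.code, x, y) ↔ Nonempty (CtxD CaTT.toSignature Γ) := by
  constructor
  · rintro ⟨Δ, h, d⟩
    rwa [← PreCtx.code_injective J.code_injective h]
  · exact fun d => ⟨Γ, rfl, d⟩

theorem derivable_ty {Γ : PreCtx J} {A : PreTy J} {y : ℕ} :
    Derivable (1, Γ.code J.code, A.code J.code, y) ↔ Nonempty (TyD CaTT.toSignature Γ A) := by
  constructor
  · rintro ⟨Δ, B, ⟨h, h'⟩, d⟩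
    rwa [← PreCtx.code_injective J.code_injective h, ← PreTy.code_injective J.code_injective h']
  · exact fun d => ⟨Γ, A, ⟨rfl, rfl⟩, d⟩

theorem derivable_tm {Γ : PreCtx J} {t : PreTm J} {A : PreTy J} :
    Derivable (2, Γ.code J.code, t.code J.code, A.code J.code) ↔
      Nonempty (TmD CaTT.toSignature Γ t A) := by
  constructor
  · rintro ⟨Δ, u, B, ⟨h, h', h''⟩, d⟩
    rwa [← PreCtx.code_injective J.code_injective h, ← PreTm.code_injective J.code_injective h',
      ← PreTy.code_injective J.code_injective h'']
  · exact fun d => ⟨Γ, t, A, ⟨rfl, rfl, rfl⟩, d⟩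

theorem derivable_sub {Δ Γ : PreCtx J} {γ : PreSub J} {k : ℕ} :
    Derivable (k + 3, Δ.code J.code, γ.code J.code, Γ.code J.code) ↔
      Nonempty (SubD CaTT.toSignature Δ γ Γ) := by
  constructor
  · rintro ⟨Δ', Γ', δ, ⟨h, h', h''⟩, d⟩
    rwa [← PreCtx.code_injective J.code_injective h, ← PreCtx.code_injective J.code_injective h',
      ← PreSub.code_injective J.code_injective h'']
  · exact fun d => ⟨Δ, Γ, γ, ⟨rfl, rfl, rfl⟩, d⟩

theorem isCtx_code (Γ : PreCtx J) : isCtx (Γ.code J.code) = true := (isCtx_iff _).2 ⟨Γ, rfl⟩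
theorem isSyn_code_ty (A : PreTy J) : (isSyn (A.code J.code)).1 = true :=
  (isSyn_iff _).1.2 ⟨A, rfl⟩
theorem isSyn_code_tm (t : PreTm J) : (isSyn (t.code J.code)).2.1 = true :=
  (isSyn_iff _).2.1.2 ⟨t, rfl⟩
theorem isSyn_code_sub (γ : PreSub J) : (isSyn (γ.code J.code)).2.2 = true :=
  (isSyn_iff _).2.2.2 ⟨γ, rfl⟩

theorem derivable_iff_ctx (Γ : PreCtx J) (x y : ℕ) : Derivable (0, Γ.code J.code, x, y) ↔
    side (0, Γ.code J.code, x, y) = true ∧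
      ∀ q ∈ premises (0, Γ.code J.code, x, y), Derivable q := by
  rw [derivable_ctx]
  match Γ with
  | .nil =>
    have h := isCtx_code .nil
    rw [PreCtx.code] at h
    simpa [side, premises, PreCtx.code, h] using ⟨CtxD.ec⟩
  | .snoc Γ x A =>
    rw [nonempty_ctxD_snoc]
    have h := isCtx_code (Γ.snoc x A)
    simp only [PreCtx.code_snoc] at h ⊢
    simp [side, premises, h, beq_false_of_ne, ctxLen_code, derivable_ctx, derivable_ty]

theorem derivable_iff_ty (Γ : PreCtx J) (A : PreTy J) (y : ℕ) :
    Derivable (1, Γ.code J.code, A.code J.code, y) ↔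
    side (1, Γ.code J.code, A.code J.code, y) = true ∧
      ∀ q ∈ premises (1, Γ.code J.code, A.code J.code, y), Derivable q := by
  rw [derivable_ty]
  have h := isSyn_code_ty A
  match A with
  | .obj =>
    rw [PreTy.code] at h
    rw [nonempty_tyD_obj]
    simp [side, premises, PreTy.code, h, isCtx_code, derivable_ctx]
  | .arr A t u =>
    rw [nonempty_tyD_arr]
    simp only [PreTy.code_arr] at h ⊢
    simp [side, premises, h, isCtx_code, beq_false_of_ne, derivable_tm]

theorem derivable_iff_tm (Γ : PreCtx J) (t : PreTm J) (A : PreTy J) :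
    Derivable (2, Γ.code J.code, t.code J.code, A.code J.code) ↔
    side (2, Γ.code J.code, t.code J.code, A.code J.code) = true ∧
      ∀ q ∈ premises (2, Γ.code J.code, t.code J.code, A.code J.code), Derivable q := by
  rw [derivable_tm]
  have h := isSyn_code_tm t
  match t with
  | .var x =>
    rw [PreTm.code] at h
    rw [nonempty_tmD_var]
    simp [side, premises, PreTm.code, h, isCtx_code, isSyn_code_ty, derivable_ctx,
      mem_code J.code_injective]
  | .con j γ =>
    -- The number of a context without term constructors does not depend on the index type.
    have hΓ : j.ctx.code = (((CaTT.Ci j).lift J).code J.code) := (PreCtx.code_lift _ _).symm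
    have hA : j.ti = CaTT.Ti j := rfl
    have hinj (B : PreTy J) : A.code J.code = B.code J.code ↔ A = B :=
      ⟨PreTy.code_injective J.code_injective, congrArg _⟩
    rw [nonempty_tmD_con]
    simp only [PreTm.code_con, hA, hΓ] at h ⊢
    have := @derivable_sub Γ ((CaTT.Ci j).lift J) γ 0
    simp only [Nat.zero_add] at this
    simp [side, premises, h, isCtx_code, isSyn_code_ty, derivable_ty, this, subst_code_ty,
      hinj]

theorem derivable_iff_sub (k : ℕ) (Δ Γ : PreCtx J) (γ : PreSub J) :
    Derivable (k + 3, Δ.code J.code, γ.code J.code, Γ.code J.code) ↔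
    side (k + 3, Δ.code J.code, γ.code J.code, Γ.code J.code) = true ∧
      ∀ q ∈ premises (k + 3, Δ.code J.code, γ.code J.code, Γ.code J.code), Derivable q := by
  rw [derivable_sub]
  have h := isSyn_code_sub γ
  have h' := isCtx_code Γ
  match γ, Γ with
  | .nil, .nil =>
    rw [nonempty_subD_nil]
    simp only [PreSub.code, PreCtx.code] at h h' ⊢
    simp [side, premises, h, h', isCtx_code, derivable_ctx]
  | .nil, .snoc Γ x A =>
    simp only [PreSub.code, PreCtx.code_snoc] at h h' ⊢
    refine iff_of_false (fun ⟨d⟩ => nomatch d) ?_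
    simp [side, beq_false_of_ne]
  | .snoc γ x t, .nil =>
    simp only [PreSub.code_snoc, PreCtx.code] at h h' ⊢
    refine iff_of_false (fun ⟨d⟩ => nomatch d) ?_
    simp [side, beq_false_of_ne]
  | .snoc γ x t, .snoc Γ y A =>
    rw [nonempty_subD_snoc, ← derivable_ctx (x := 0) (y := 0)]
    have hs := @derivable_sub Δ Γ γ 0
    simp only [Nat.zero_add] at hs
    simp only [PreSub.code_snoc, PreCtx.code_snoc] at h h' ⊢
    simp [side, premises, h, h', isCtx_code, beq_false_of_ne, hs, derivable_tm, subst_code_ty]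

/-- The rules are directed by the conclusion: a judgement is derivable if and only if the side
conditions and the premises of the one rule that fits it hold. -/
theorem derivable_iff (q : ℕ × ℕ × ℕ × ℕ) :
    Derivable q ↔ side q = true ∧ ∀ q' ∈ premises q, Derivable q' := by
  obtain ⟨k, n, m, l⟩ := q
  constructor
  · intro h
    match k with
    | 0 =>
      obtain ⟨Γ, rfl, d⟩ := h
      exact (derivable_iff_ctx Γ m l).1 (derivable_ctx.2 d)
    | 1 =>
      obtain ⟨Γ, A, ⟨rfl, rfl⟩, d⟩ := h
      exact (derivable_iff_ty Γ A l).1 (derivable_ty.2 d)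
    | 2 =>
      obtain ⟨Γ, t, A, ⟨rfl, rfl, rfl⟩, d⟩ := h
      exact (derivable_iff_tm Γ t A).1 (derivable_tm.2 d)
    | k + 3 =>
      obtain ⟨Δ, Γ, γ, ⟨rfl, rfl, rfl⟩, d⟩ := h
      exact (derivable_iff_sub k Δ Γ γ).1 (derivable_sub.2 d)
  · rintro ⟨hs, hp⟩
    have hn : isCtx n = true := by
      rw [side, Bool.and_eq_true] at hs
      exact hs.1
    obtain ⟨Γ, rfl⟩ := (isCtx_iff n).1 hn
    match k with
    | 0 => exact (derivable_iff_ctx Γ m l).2 ⟨hs, hp⟩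
    | 1 =>
      have h : (isSyn m).1 = true := by simpa [side, hn] using hs
      obtain ⟨A, rfl⟩ := (isSyn_iff m).1.1 h
      exact (derivable_iff_ty Γ A l).2 ⟨hs, hp⟩
    | 2 =>
      have h : ((isSyn m).2.1 && (isSyn l).1) = true := by
        simp only [side, hn, Bool.true_and] at hs
        exact (Bool.and_eq_true _ _ ▸ hs).1
      rw [Bool.and_eq_true, (isSyn_iff m).2.1, (isSyn_iff l).1] at h
      obtain ⟨⟨t, rfl⟩, A, rfl⟩ := h
      exact (derivable_iff_tm Γ t A).2 ⟨hs, hp⟩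
    | k + 3 =>
      have h : ((isSyn m).2.2 && isCtx l) = true := by
        simp only [side, hn, Bool.true_and] at hs
        exact (Bool.and_eq_true _ _ ▸ hs).1
      rw [Bool.and_eq_true, (isSyn_iff m).2.2, isCtx_iff l] at h
      obtain ⟨⟨γ, rfl⟩, Θ, rfl⟩ := h
      exact (derivable_iff_sub k Γ Θ γ).2 ⟨hs, hp⟩

theorem primrecPred_derivable : PrimrecPred Derivable :=
  .of_forall_mem primrec_side primrec_premises primrec_size (fun _ _ => size_lt_of_mem_premises)
    derivable_iff

end Code

theorem mainTheorem8 :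
    -- weakening, and derivability of the constituents of derivable judgements
    ((∀ (Γ : PreCtx J) (A : PreTy J) (y : ℕ) (B : PreTy J),
        Nonempty (TyD CaTT.toSignature Γ A) → Nonempty (CtxD CaTT.toSignature (Γ.snoc y B)) →
        Nonempty (TyD CaTT.toSignature (Γ.snoc y B) A)) ∧
      (∀ (Γ : PreCtx J) (t : PreTm J) (A : PreTy J) (y : ℕ) (B : PreTy J),
        Nonempty (TmD CaTT.toSignature Γ t A) → Nonempty (CtxD CaTT.toSignature (Γ.snoc y B)) →
        Nonempty (TmD CaTT.toSignature (Γ.snoc y B) t A)) ∧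
      (∀ (Δ Γ : PreCtx J) (γ : PreSub J) (y : ℕ) (B : PreTy J),
        Nonempty (SubD CaTT.toSignature Δ γ Γ) → Nonempty (CtxD CaTT.toSignature (Δ.snoc y B)) →
        Nonempty (SubD CaTT.toSignature (Δ.snoc y B) γ Γ)) ∧
      (∀ (Γ : PreCtx J) (A : PreTy J),
        Nonempty (TyD CaTT.toSignature Γ A) → Nonempty (CtxD CaTT.toSignature Γ)) ∧
      (∀ (Γ : PreCtx J) (t : PreTm J) (A : PreTy J),
        Nonempty (TmD CaTT.toSignature Γ t A) →
        Nonempty (CtxD CaTT.toSignature Γ) ∧ Nonempty (TyD CaTT.toSignature Γ A)) ∧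
      (∀ (Δ Γ : PreCtx J) (γ : PreSub J),
        Nonempty (SubD CaTT.toSignature Δ γ Γ) →
        Nonempty (CtxD CaTT.toSignature Γ) ∧ Nonempty (CtxD CaTT.toSignature Δ)) ∧
      (∀ (Γ : PreCtx J) (x : ℕ) (A : PreTy J),
        Nonempty (CtxD CaTT.toSignature (Γ.snoc x A)) → Nonempty (CtxD CaTT.toSignature Γ)) ∧
      (∀ (Γ : PreCtx J) (A : PreTy J) (t u : PreTm J),
        Nonempty (TyD CaTT.toSignature Γ (.arr A t u)) →
        Nonempty (TmD CaTT.toSignature Γ t A) ∧ Nonempty (TmD CaTT.toSignature Γ u A))) ∧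
    -- the identity laws that hold on all raw objects
    ((∀ (Γ : PreCtx J) (A : PreTy J), A.subst (PreSub.ident Γ) = A) ∧
      (∀ (Γ : PreCtx J) (t : PreTm J), t.subst (PreSub.ident Γ) = t) ∧
      (∀ (Δ : PreCtx J) (γ : PreSub J), γ.comp (PreSub.ident Δ) = γ)) ∧
    -- the syntax is a category with families, for the syntactic operations
    (∃ C : CwF CaTT.Ctx (fun Δ Γ => CaTT.Sub Δ.1 Γ.1) (fun Γ => CaTT.Ty Γ.1)
        (fun Γ A => CaTT.Tm Γ.1 A.1),
      (∀ Γ : CaTT.Ctx, (C.ident Γ).1 = PreSub.ident Γ.1) ∧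
      (∀ (Γ Δ Θ : CaTT.Ctx) (γ : CaTT.Sub Δ.1 Γ.1) (δ : CaTT.Sub Θ.1 Δ.1),
        (C.comp γ δ).1 = γ.1.comp δ.1) ∧
      C.empty.1 = PreCtx.nil ∧
      (∀ Γ : CaTT.Ctx, (C.toEmpty Γ).1 = PreSub.nil) ∧
      (∀ (Γ Δ : CaTT.Ctx) (A : CaTT.Ty Γ.1) (γ : CaTT.Sub Δ.1 Γ.1),
        (C.substTy A γ).1 = A.1.subst γ.1) ∧
      (∀ (Γ Δ : CaTT.Ctx) (A : CaTT.Ty Γ.1) (t : CaTT.Tm Γ.1 A.1) (γ : CaTT.Sub Δ.1 Γ.1),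
        (C.substTm t γ).1 = t.1.subst γ.1) ∧
      (∀ (Γ : CaTT.Ctx) (A : CaTT.Ty Γ.1), (C.ext Γ A).1 = Γ.1.snoc Γ.1.length A.1) ∧
      (∀ (Γ : CaTT.Ctx) (A : CaTT.Ty Γ.1), (C.proj A).1 = PreSub.ident Γ.1) ∧
      (∀ (Γ : CaTT.Ctx) (A : CaTT.Ty Γ.1), (C.last A).1 = PreTm.var Γ.1.length) ∧
      (∀ (Γ Δ : CaTT.Ctx) (A : CaTT.Ty Γ.1) (γ : CaTT.Sub Δ.1 Γ.1)
        (t : CaTT.Tm Δ.1 (C.substTy A γ).1),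
        (C.pair γ t).1 = γ.1.snoc Γ.1.length t.1)) ∧
    -- uniqueness of derivation trees
    ((∀ Γ : PreCtx J, Subsingleton (CtxD CaTT.toSignature Γ)) ∧
      (∀ (Γ : PreCtx J) (A : PreTy J), Subsingleton (TyD CaTT.toSignature Γ A)) ∧
      (∀ (Γ : PreCtx J) (t : PreTm J) (A : PreTy J), Subsingleton (TmD CaTT.toSignature Γ t A)) ∧
      (∀ (Δ Γ : PreCtx J) (γ : PreSub J), Subsingleton (SubD CaTT.toSignature Δ γ Γ)) ∧
      (∀ (Γ : PreCtx Empty) (x : ℕ) (A : PreTy Empty), Subsingleton (PsAux Γ x A)) ∧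
      (∀ Γ : PreCtx Empty, Subsingleton (Ps Γ))) ∧
    -- the disk and sphere contexts are valid, and the sphere contexts classify the types
    ((∀ n : ℕ, Nonempty (CtxD CaTT.toSignature (sphere J n)) ∧
        Nonempty (CtxD CaTT.toSignature (disk J n)) ∧
        Nonempty (TyD CaTT.toSignature (sphere J n) (univTy J n))) ∧
      (∀ Γ : PreCtx J, ∃ E : (Σ n : ℕ, CaTT.Sub Γ (sphere J n)) ≃ CaTT.Ty Γ,
        ∀ (n : ℕ) (γ : CaTT.Sub Γ (sphere J n)), (E ⟨n, γ⟩).1 = (univTy J n).subst γ.1)) ∧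
    -- decidability of type checking: the numbering of the raw syntax is injective, and the sets of
    -- (tuples of) numbers of derivable judgements are computable
    ((Function.Injective (PreCtx.code J.code) ∧ Function.Injective (PreTy.code J.code) ∧
        Function.Injective (PreTm.code J.code) ∧ Function.Injective (PreSub.code J.code)) ∧
      ComputablePred (fun n : ℕ =>
        ∃ Γ : PreCtx J, Γ.code J.code = n ∧ Nonempty (CtxD CaTT.toSignature Γ)) ∧
      ComputablePred (fun n : ℕ × ℕ =>
        ∃ (Γ : PreCtx J) (A : PreTy J), (Γ.code J.code, A.code J.code) = n ∧
          Nonempty (TyD CaTT.toSignature Γ A)) ∧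
      ComputablePred (fun n : ℕ × ℕ × ℕ =>
        ∃ (Γ : PreCtx J) (t : PreTm J) (A : PreTy J),
          (Γ.code J.code, t.code J.code, A.code J.code) = n ∧
          Nonempty (TmD CaTT.toSignature Γ t A)) ∧
      ComputablePred (fun n : ℕ × ℕ × ℕ =>
        ∃ (Δ Γ : PreCtx J) (γ : PreSub J),
          (Δ.code J.code, Γ.code J.code, γ.code J.code) = n ∧
          Nonempty (SubD CaTT.toSignature Δ γ Γ))) := by
  refine ⟨⟨?_, ?_, ?_, ?_, ?_, ?_, ?_, ?_⟩, ⟨PreTy.subst_ident, PreTm.subst_ident,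
    PreSub.comp_ident⟩, ⟨CaTT.toSignature.cwf, fun _ => rfl, fun _ _ _ _ _ => rfl, rfl,
    fun _ => rfl, fun _ _ _ _ => rfl, fun _ _ _ _ _ => rfl, fun _ _ => rfl, fun _ _ => rfl,
    fun _ _ => rfl, fun _ _ _ _ _ => rfl⟩, ⟨fun _ => inferInstance, fun _ _ => inferInstance,
    fun _ _ _ => inferInstance, fun _ _ _ => inferInstance, fun _ _ _ => inferInstance,
    fun _ => inferInstance⟩, ⟨fun n => ⟨⟨sphereD n⟩, ⟨diskD n⟩, ⟨univTyD n⟩⟩,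
    fun Γ => ⟨sphereEquiv CaTT.toSignature Γ, fun _ _ => rfl⟩⟩,
    ⟨fun _ _ => PreCtx.code_injective J.code_injective,
      fun _ _ => PreTy.code_injective J.code_injective,
      fun _ _ => PreTm.code_injective J.code_injective,
      fun _ _ => PreSub.code_injective J.code_injective⟩, ?_, ?_, ?_, ?_⟩
  · exact fun _ _ _ _ ⟨d⟩ ⟨e⟩ => ⟨d.weaken e⟩
  · exact fun _ _ _ _ _ ⟨d⟩ ⟨e⟩ => ⟨d.weaken e⟩
  · exact fun _ _ _ _ _ ⟨d⟩ ⟨e⟩ => ⟨d.weaken e⟩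
  · exact fun _ _ ⟨d⟩ => ⟨d.ctx⟩
  · exact fun _ _ _ ⟨d⟩ => ⟨⟨d.ctx⟩, ⟨d.ty⟩⟩
  · exact fun _ _ _ ⟨d⟩ => ⟨⟨d.target⟩, ⟨d.source⟩⟩
  · exact fun _ _ _ ⟨c⟩ => ⟨c.tail⟩
  · exact fun _ _ _ _ => nonempty_tyD_arr.1
  · exact (Code.primrecPred_derivable.comp
      (f := fun n : ℕ => (0, n, 0, 0)) (by fun_prop)).computablePred
  · refine ((Code.primrecPred_derivable.comp
      (f := fun n : ℕ × ℕ => (1, n.1, n.2, 0)) (by fun_prop)).of_eq fun n => ?_).computablePred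
    simp only [Code.Derivable, Prod.ext_iff]
  · refine ((Code.primrecPred_derivable.comp
      (f := fun n : ℕ × ℕ × ℕ => (2, n.1, n.2.1, n.2.2)) (by fun_prop)).of_eq
        fun n => ?_).computablePred
    simp only [Code.Derivable, Prod.ext_iff]
  · refine ((Code.primrecPred_derivable.comp
      (f := fun n : ℕ × ℕ × ℕ => (3, n.1, n.2.2, n.2.1)) (by fun_prop)).of_eq
        fun n => ?_).computablePred
    simp only [Code.Derivable, Prod.ext_iff]
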